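/- Conventions. A graph $\Gamma=(V\Gamma,E\Gamma)$ consists of a vertex set and a set of unordered pairs of distinct vertices; $|\Gamma|$ is the number of vertices. Its topological realisation, also denoted $\Gamma$, is obtained from the disjoint union of the discrete set $V\Gamma$ and one closed unit interval for each edge by gluing the two endpoints of each interval to the two vertices of that edge. A topological embedding $g:\Gamma\to Z$ into a metric space $Z$ is $1$-thick if $d_Z(g(x),g(y))\ge 1$ whenever $x,y$ are two distinct vertices, or $x$ lies on a (closed) edge and $y$ is a vertex not contained in that edge, or $x,y$ lie on two disjoint (closed) edges. If $Z$ carries a measure, the volume of $g$ is the measure of the $1$-neighbourhood $\{z\in Z: d_Z(z,g(\Gamma))\le 1\}$ of its image. Real hyperbolic space is $\mathbb{H}^q_{\mathbb{R}}=\{x\in\mathbb{R}^q: x_q>0\}$ with the metric $d(x,y)=\cosh^{-1}\left(1+\frac{\|x-y\|_2^2}{2x_qy_q}\right)$ and the volume $x_q^{-q}\,dx_1\cdots dx_q$ ($\mathbb{H}^0_{\mathbb{R}}$ is a single point of mass $1$). The product $\mathbb{R}^r\times\mathbb{H}^q_{\mathbb{R}}$ carries the metric $d\big((x,u),(y,v)\big)=\left(\|x-y\|_2^2+d_{\mathbb{H}^q_{\mathbb{R}}}(u,v)^2\right)^{1/2}$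 and the product measure. Theorem. Let $q,r\ge 0$ be integers with $q+r\ge 3$, let $X=\mathbb{R}^r\times\mathbb{H}^q_{\mathbb{R}}$, and let $d\in\mathbb{N}$. There is a constant $C=C(q,r,d)>0$ such that every finite graph $\Gamma$ with maximal degree at most $d$ admits a $1$-thick topological embedding into $X$ with volume $$\le C\,|\Gamma|^{1+1/(q+r-2)}.$$ -/

import Mathlib

open MeasureTheory

noncomputable section

namespace ThickEmbedding

/-! ### Real hyperbolic space: the upper half-space model -/

/-- The last coordinate of a point of `ℝ^q`. For `q = 0` there is no coordinate and the value is
`1`, so that hyperbolic space of dimension `0` is a single point. -/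
def height : {q : ℕ} → EuclideanSpace ℝ (Fin q) → ℝ
  | 0, _ => 1
  | n + 1, x => x (Fin.last n)

/-- Real hyperbolic space of dimension `q`: the points of `ℝ^q` with positive last coordinate. -/
def HyperbolicSpace (q : ℕ) : Type :=
  {x : EuclideanSpace ℝ (Fin q) // 0 < height x}

namespace HyperbolicSpace

variable {q : ℕ}

instance : TopologicalSpace (HyperbolicSpace q) :=
  inferInstanceAs (TopologicalSpace {x : EuclideanSpace ℝ (Fin q) // 0 < height x})

instance : MeasurableSpace (HyperbolicSpace q) :=
  inferInstanceAs (MeasurableSpace {x : EuclideanSpace ℝ (Fin q) // 0 < height x})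

instance : Dist (HyperbolicSpace q) :=
  ⟨fun x y => Real.arcosh (1 + ‖x.1 - y.1‖ ^ 2 / (2 * height x.1 * height y.1))⟩

theorem dist_def (x y : HyperbolicSpace q) :
    dist x y = Real.arcosh (1 + ‖x.1 - y.1‖ ^ 2 / (2 * height x.1 * height y.1)) := rfl

theorem one_le_arg (x y : HyperbolicSpace q) :
    1 ≤ 1 + ‖x.1 - y.1‖ ^ 2 / (2 * height x.1 * height y.1) := by
  have hx := x.2
  have hy := y.2
  have : 0 ≤ ‖x.1 - y.1‖ ^ 2 / (2 * height x.1 * height y.1) := by positivity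
  linarith

theorem hdist_nonneg (x y : HyperbolicSpace q) : 0 ≤ dist x y :=
  Real.arcosh_nonneg (one_le_arg x y)

theorem cosh_dist (x y : HyperbolicSpace q) :
    Real.cosh (dist x y) = 1 + ‖x.1 - y.1‖ ^ 2 / (2 * height x.1 * height y.1) :=
  Real.cosh_arcosh (one_le_arg x y)

theorem hdist_comm (x y : HyperbolicSpace q) : dist x y = dist y x := by
  rw [dist_def, dist_def, norm_sub_rev, mul_right_comm]

/-- The reflection of a point in the boundary hyperplane. -/
theorem exists_reflection (b : HyperbolicSpace q) (hq : q ≠ 0) :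
    ∃ b' : EuclideanSpace ℝ (Fin q), ‖b.1 - b'‖ = 2 * height b.1 ∧
      ∀ a : HyperbolicSpace q, ‖a.1 - b'‖ ^ 2 = ‖a.1 - b.1‖ ^ 2 + 4 * height a.1 * height b.1 := by
  obtain ⟨n, rfl⟩ := Nat.exists_eq_succ_of_ne_zero hq
  let e : EuclideanSpace ℝ (Fin (n + 1)) := EuclideanSpace.single (Fin.last n) 1
  have he : ‖e‖ = 1 := by simp [e]
  have hb : 0 < height b.1 := b.2
  refine ⟨b.1 - (2 * height b.1) • e, ?_, fun a => ?_⟩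
  · rw [sub_sub_cancel, norm_smul, he, mul_one, Real.norm_of_nonneg (by positivity)]
  · have h1 : a.1 - (b.1 - (2 * height b.1) • e) = (a.1 - b.1) + (2 * height b.1) • e := by abel
    have h2 : inner ℝ (a.1 - b.1) e = height a.1 - height b.1 := by
      simp [e, height, EuclideanSpace.inner_single_right]
    rw [h1, norm_add_sq_real, inner_smul_right, h2, norm_smul, he,
      Real.norm_of_nonneg (by positivity)]
    ring

theorem sinh_half_dist (x y : HyperbolicSpace q) :
    Real.sinh (dist x y / 2) = ‖x.1 - y.1‖ / (2 * √(height x.1 * height y.1)) := by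
  have hx := x.2
  have hy := y.2
  have h0 : 0 ≤ Real.sinh (dist x y / 2) :=
    Real.sinh_nonneg_iff.2 (by linarith [hdist_nonneg x y])
  rw [← sq_eq_sq₀ h0 (by positivity), div_pow, mul_pow, Real.sq_sqrt (by positivity)]
  have h := cosh_dist x y
  rw [show dist x y = 2 * (dist x y / 2) by ring, Real.cosh_two_mul, Real.cosh_sq'] at h
  have h3 : ‖x.1 - y.1‖ ^ 2 / (2 * height x.1 * height y.1) =
      2 * (‖x.1 - y.1‖ ^ 2 / (2 ^ 2 * (height x.1 * height y.1))) := by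
    field_simp
  linarith

theorem cosh_half_dist (x y : HyperbolicSpace q) (y' : EuclideanSpace ℝ (Fin q))
    (h : ‖x.1 - y'‖ ^ 2 = ‖x.1 - y.1‖ ^ 2 + 4 * height x.1 * height y.1) :
    Real.cosh (dist x y / 2) = ‖x.1 - y'‖ / (2 * √(height x.1 * height y.1)) := by
  have hx := x.2
  have hy := y.2
  rw [← sq_eq_sq₀ (Real.cosh_pos _).le (by positivity), Real.cosh_sq', sinh_half_dist, div_pow,
    div_pow, mul_pow, Real.sq_sqrt (by positivity), h]
  field_simp
  ring

theorem eq_of_dim_zero (hq : q = 0) (x y : HyperbolicSpace q) : x = y := by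
  subst hq
  exact Subtype.ext (Subsingleton.elim _ _)

theorem hdist_self (x : HyperbolicSpace q) : dist x x = 0 := by
  simp [dist_def]

theorem hdist_triangle (a b c : HyperbolicSpace q) : dist a c ≤ dist a b + dist b c := by
  by_cases hq : q = 0
  · rw [eq_of_dim_zero hq a b, eq_of_dim_zero hq c b, hdist_self]
    simp
  obtain ⟨b', hbb, hb'⟩ := exists_reflection b hq
  have ha := a.2
  have hb := b.2
  have hc := c.2
  have hpt := EuclideanGeometry.mul_dist_le_mul_dist_add_mul_dist a.1 b.1 c.1 b'
  simp only [dist_eq_norm, hbb] at hpt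
  have key : Real.sinh (dist a c / 2) ≤ Real.sinh ((dist a b + dist b c) / 2) := by
    rw [add_div, Real.sinh_add, hdist_comm b c, sinh_half_dist, sinh_half_dist, sinh_half_dist,
      cosh_half_dist a b b' (hb' a), cosh_half_dist c b b' (hb' c), Real.sqrt_mul ha.le,
      Real.sqrt_mul ha.le, Real.sqrt_mul hc.le]
    have sa := Real.sqrt_pos.2 ha
    have sb := Real.sqrt_pos.2 hb
    have sc := Real.sqrt_pos.2 hc
    have e : ‖a.1 - b.1‖ / (2 * (√(height a.1) * √(height b.1))) *
          (‖c.1 - b'‖ / (2 * (√(height c.1) * √(height b.1)))) +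
        ‖a.1 - b'‖ / (2 * (√(height a.1) * √(height b.1))) *
          (‖c.1 - b.1‖ / (2 * (√(height c.1) * √(height b.1)))) =
        (‖a.1 - b.1‖ * ‖c.1 - b'‖ + ‖b.1 - c.1‖ * ‖a.1 - b'‖) / (2 * height b.1) /
          (2 * (√(height a.1) * √(height c.1))) := by
      rw [norm_sub_rev b.1 c.1]
      have := Real.sq_sqrt hb.le
      field_simp
      rw [this]
      field_simp
    rw [e]
    gcongr
    rw [le_div_iff₀ (by positivity)]
    exact hpt
  have := Real.sinh_le_sinh.1 key
  linarith

theorem eq_of_hdist_eq_zero {x y : HyperbolicSpace q} (h : dist x y = 0) : x = y := by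
  have hx := x.2
  have hy := y.2
  have h1 := sinh_half_dist x y
  rw [h, zero_div, Real.sinh_zero, eq_comm, div_eq_zero_iff] at h1
  rcases h1 with h1 | h1
  · exact Subtype.ext (sub_eq_zero.1 (norm_eq_zero.1 h1))
  · have := Real.sqrt_pos.2 (mul_pos hx hy)
    linarith

/-- The hyperbolic metric, with the topology that it induces. -/
@[reducible]
def metricSpaceAux : MetricSpace (HyperbolicSpace q) where
  dist := dist
  dist_self := hdist_self
  dist_comm := hdist_comm
  dist_triangle := hdist_triangle
  eq_of_dist_eq_zero := eq_of_hdist_eq_zero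

theorem continuous_height : Continuous (height : EuclideanSpace ℝ (Fin q) → ℝ) := by
  cases q with
  | zero => exact continuous_const
  | succ n =>
    change Continuous fun x : EuclideanSpace ℝ (Fin (n + 1)) => x (Fin.last n)
    fun_prop

theorem height_le (x y : EuclideanSpace ℝ (Fin q)) : height x ≤ height y + ‖x - y‖ := by
  cases q with
  | zero => simp [height]
  | succ n =>
    have := (le_abs_self _).trans (PiLp.norm_apply_le (x - y) (Fin.last n))
    simp only [PiLp.sub_apply] at this
    simp only [height]
    linarith

theorem norm_sub_sq_le (x y : HyperbolicSpace q) :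
    ‖x.1 - y.1‖ ^ 2 ≤
      2 * height y.1 * (Real.cosh (dist x y) - 1) * (height y.1 + ‖x.1 - y.1‖) := by
  have hx := x.2
  have hy := y.2
  have h := cosh_dist x y
  have h1 : ‖x.1 - y.1‖ ^ 2 = 2 * height y.1 * (Real.cosh (dist x y) - 1) * height x.1 := by
    rw [h]
    field_simp
    ring
  rw [h1]
  have := Real.one_le_cosh (dist x y)
  have h2 : 0 ≤ 2 * height y.1 * (Real.cosh (dist x y) - 1) :=
    mul_nonneg (by positivity) (by linarith)
  exact mul_le_mul_of_nonneg_left (height_le _ _) h2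

/-- The hyperbolic metric. Its topology is (definitionally) the Euclidean topology of the
half-space. -/
instance : MetricSpace (HyperbolicSpace q) :=
  metricSpaceAux.replaceTopology <| by
    refine le_antisymm (continuous_id_iff_le.1 ?_) ?_
    · refine (@continuous_iff_continuous_dist (HyperbolicSpace q) (HyperbolicSpace q)
        metricSpaceAux.toPseudoMetricSpace _ _).2 ?_
      change Continuous fun p : HyperbolicSpace q × HyperbolicSpace q =>
        Real.arcosh (1 + ‖p.1.1 - p.2.1‖ ^ 2 / (2 * height p.1.1 * height p.2.1))
      have hv : Continuous fun x : HyperbolicSpace q => x.1 := continuous_subtype_val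
      have h1 : Continuous fun p : HyperbolicSpace q × HyperbolicSpace q => p.1.1 :=
        hv.comp continuous_fst
      have h2 : Continuous fun p : HyperbolicSpace q × HyperbolicSpace q => p.2.1 :=
        hv.comp continuous_snd
      refine Real.continuousOn_arcosh.comp_continuous ?_ fun p => one_le_arg p.1 p.2
      refine continuous_const.add (((h1.sub h2).norm.pow 2).div
        ((continuous_const.mul (continuous_height.comp h1)).mul (continuous_height.comp h2)) ?_)
      intro p
      have hx := p.1.2
      have hy := p.2.2
      positivity
    · let : MetricSpace (HyperbolicSpace q) := metricSpaceAux
      refine le_of_nhds_le_nhds fun z => ?_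
      have hn : @nhds (HyperbolicSpace q) instTopologicalSpace z =
          Filter.comap Subtype.val (nhds z.1) := nhds_induced _ _
      rw [hn]
      refine (Metric.nhds_basis_ball.le_basis_iff (Metric.nhds_basis_ball.comap _)).2
        fun R hR => ?_
      have hz : 0 < height z.1 := z.2
      have hc : 0 < R ^ 2 / (2 * height z.1 * (height z.1 + R)) := by positivity
      refine ⟨Real.arcosh (1 + R ^ 2 / (2 * height z.1 * (height z.1 + R))),
        Real.arcosh_pos (by linarith), fun w hw => ?_⟩
      have hw' : dist w z < Real.arcosh (1 + R ^ 2 / (2 * height z.1 * (height z.1 + R))) := hw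
      have h1 : Real.cosh (dist w z) < 1 + R ^ 2 / (2 * height z.1 * (height z.1 + R)) := by
        rw [← Real.cosh_arcosh (x := 1 + R ^ 2 / (2 * height z.1 * (height z.1 + R)))
          (by linarith)]
        exact Real.cosh_lt_cosh.2 (by
          rwa [abs_of_nonneg (hdist_nonneg w z), abs_of_nonneg (Real.arcosh_nonneg (by linarith))])
      have h2 := norm_sub_sq_le w z
      change dist w.1 z.1 < R
      rw [dist_eq_norm]
      by_contra! hle
      set s := ‖w.1 - z.1‖ with hs
      have h3 : 2 * height z.1 * (Real.cosh (dist w z) - 1) < R ^ 2 / (height z.1 + R) := by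
        have : 2 * height z.1 * (R ^ 2 / (2 * height z.1 * (height z.1 + R))) =
            R ^ 2 / (height z.1 + R) := by field_simp
        rw [← this]
        exact mul_lt_mul_of_pos_left (by linarith) (by positivity)
      have h4 : s ^ 2 < R ^ 2 / (height z.1 + R) * (height z.1 + s) :=
        h2.trans_lt (mul_lt_mul_of_pos_right h3 (by linarith))
      rw [div_mul_eq_mul_div, lt_div_iff₀ (by positivity)] at h4
      nlinarith [mul_nonneg (sub_nonneg.2 hle) hz.le, mul_nonneg (sub_nonneg.2 hle) hR.le,
        mul_nonneg (mul_nonneg (sub_nonneg.2 hle) hR.le) (hR.le.trans hle)]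

/-- The hyperbolic volume `x_q ^ (-q) dx_1 ⋯ dx_q`. -/
instance : MeasureSpace (HyperbolicSpace q) where
  volume := (Measure.comap (fun x : HyperbolicSpace q => x.1)
    (volume : Measure (EuclideanSpace ℝ (Fin q)))).withDensity
      fun x : HyperbolicSpace q => ENNReal.ofReal ((height x.1 ^ q)⁻¹)

end HyperbolicSpace

/-- The Riemannian product `ℝ^r × ℍ^q`, with the `ℓ²` product metric. -/
abbrev EucHyp (r q : ℕ) : Type :=
  WithLp 2 (EuclideanSpace ℝ (Fin r) × HyperbolicSpace q)

/-- The Riemannian volume of `ℝ^r × ℍ^q`, that is, the product measure. -/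
def eucHypVolume (r q : ℕ) : Measure (EucHyp r q) :=
  Measure.map (WithLp.toLp 2)
    ((volume : Measure (EuclideanSpace ℝ (Fin r))).prod (volume : Measure (HyperbolicSpace q)))

/-! ### The topological realisation of a graph -/

universe u

variable {V : Type u}

/-- The disjoint union of the (discrete) vertex set and of one unit interval per edge. -/
abbrev PreRealization (Γ : SimpleGraph V) : Type u :=
  (Σ _ : V, Unit) ⊕ (Σ _ : Γ.edgeSet, unitInterval)

/-- The endpoints of the interval of an edge `e` are glued to the two vertices of `e`, in an
arbitrary order: `Quot.out e` is an ordered pair which represents the unordered pair `e`. -/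
inductive Glue (Γ : SimpleGraph V) : PreRealization Γ → PreRealization Γ → Prop
  | source (e : Γ.edgeSet) : Glue Γ (Sum.inr ⟨e, 0⟩) (Sum.inl ⟨(Quot.out e.1).1, ()⟩)
  | target (e : Γ.edgeSet) : Glue Γ (Sum.inr ⟨e, 1⟩) (Sum.inl ⟨(Quot.out e.1).2, ()⟩)

/-- The topological realisation of a graph, with the quotient topology. -/
def Realization (Γ : SimpleGraph V) : Type u := Quot (Glue Γ)

instance (Γ : SimpleGraph V) : TopologicalSpace (Realization Γ) :=
  inferInstanceAs (TopologicalSpace (Quot (Glue Γ)))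

/-- The point of the realisation given by a vertex. -/
def Realization.vertex (Γ : SimpleGraph V) (v : V) : Realization Γ :=
  Quot.mk _ (Sum.inl ⟨v, ()⟩)

/-- The point with parameter `t` on the (closed) edge `e` of the realisation. -/
def Realization.edgePoint (Γ : SimpleGraph V) (e : Γ.edgeSet) (t : unitInterval) : Realization Γ :=
  Quot.mk _ (Sum.inr ⟨e, t⟩)

/-! ### Thick embeddings -/

/-- The map `g` is an `ε`-thick topological embedding: the images of two distinct vertices, of an
edge and a vertex not contained in it, and of two disjoint edges, are at distance at least `ε`. -/
structure IsThickEmbedding {Z : Type*} [MetricSpace Z] (Γ : SimpleGraph V) (ε : ℝ)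
    (g : Realization Γ → Z) : Prop where
  isEmbedding : Topology.IsEmbedding g
  vertex_vertex : ∀ v w : V, v ≠ w →
    ε ≤ dist (g (Realization.vertex Γ v)) (g (Realization.vertex Γ w))
  edge_vertex : ∀ (e : Γ.edgeSet) (v : V), v ∉ e.1 → ∀ t : unitInterval,
    ε ≤ dist (g (Realization.edgePoint Γ e t)) (g (Realization.vertex Γ v))
  edge_edge : ∀ e e' : Γ.edgeSet, (∀ v : V, v ∈ e.1 → v ∉ e'.1) → ∀ s t : unitInterval,
    ε ≤ dist (g (Realization.edgePoint Γ e s)) (g (Realization.edgePoint Γ e' t))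

/-- The volume of a map: the measure of the `1`-neighbourhood of its image. -/
def imageVolume {Y Z : Type*} [MetricSpace Z] [MeasurableSpace Z] (μ : Measure Z) (g : Y → Z) :
    ENNReal :=
  μ (Metric.cthickening 1 (Set.range g))

end ThickEmbedding

end

/-!
Put `k = q + r - 2`. The vertices of `Γ` are placed in a grid `[L]^k` with `L` about `|Γ|^(1/k)`,
and the edges are routed through `[M]^k × [T] × [2k + 2]`, where `M` and `T` are bounded multiples
of `L`. The volume of this box is a multiple of `L^(k + 1)`, hence of `|Γ|^(1 + 1/k)`. The
coordinate in `[T]` is called the level and the one in `[2k + 2]` the layer.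

*Routing.* Each vertex is blown up to a cube of the grid which has a port for each edge at the
vertex. Each edge `e` chooses an intermediate grid point `w` and a level `t`. Its route goes up
from the first port to level `t`, changes the coordinates one by one to those of `w`, then, in the
opposite order, to those of the second port, and goes down. Each change of a coordinate has its
own layer, so that two routes can only meet if on the same level they change the same coordinate
on the same line. The number of pairs `(w, t)` for which this happens with one of the other edges
is at most `2k M^(k + 1)`, so with more than `2k M` levels the edges can choose greedily
(`exists_routing`, `routeSet_disjoint`, `exists_layout`).

*Thickness.* The routes are disjoint sets of lattice points, in each of which a self-avoiding
lattice path joins the two ports. Straight segments join the ports to the vertex. Thickness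
follows from one observation: two boxes with integer corners and without a common lattice point
are separated by at least `1` in some coordinate (`InCell.exists_one_le`). Since a vertex can have
more edges than a lattice point has neighbours, the segments at the vertices do not follow the
lattice; those at one vertex meet only there, because their ports differ and the level is the
parameter on each of them (`Layout.injective_toMap`).

*Geometry.* If `0 < q`, the layer becomes the logarithm of the height in the half-space. As the
number of layers does not depend on `Γ`, the heights are bounded, and after a rescaling of the
other hyperbolic coordinates a gap of `1` in any coordinate gives distance at least `1`, while the volume of
a neighbourhood of the box is still at most a multiple of the product of its sides
(`one_le_dist_toEucHyp`, `exists_volume_le`). If `q = 0`, the map is the identity.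
-/

noncomputable section

namespace ThickEmbedding

universe u v

/-! ### Integer boxes -/

section Lattice

variable {ι : Type*}

/-- The point `x` lies in an integer box all of whose lattice points belong to `Z`. -/
def InCell (x : ι → ℝ) (Z : Set (ι → ℤ)) : Prop :=
  ∃ lo hi : ι → ℤ, (∀ i, (lo i : ℝ) ≤ x i ∧ x i ≤ hi i) ∧ Set.Icc lo hi ⊆ Z

theorem InCell.mono {x : ι → ℝ} {Z Z' : Set (ι → ℤ)} (h : InCell x Z) (hZ : Z ⊆ Z') :
    InCell x Z' :=
  let ⟨lo, hi, hx, hs⟩ := h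
  ⟨lo, hi, hx, hs.trans hZ⟩

theorem inCell_intCast {z : ι → ℤ} {Z : Set (ι → ℤ)} (hz : z ∈ Z) :
    InCell (fun i => (z i : ℝ)) Z :=
  ⟨z, z, fun _ => ⟨le_rfl, le_rfl⟩, by simpa using hz⟩

/-- Two integer boxes without a common lattice point are disjoint in some coordinate, hence at
distance at least `1` in that coordinate. -/
theorem InCell.exists_one_le {x y : ι → ℝ} {Z Z' : Set (ι → ℤ)} (hx : InCell x Z)
    (hy : InCell y Z') (hZ : Disjoint Z Z') : ∃ i, 1 ≤ |x i - y i| := by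
  obtain ⟨lo, hi, hx, hs⟩ := hx
  obtain ⟨lo', hi', hy, hs'⟩ := hy
  by_contra! hlt
  have key : ∀ i, max (lo i) (lo' i) ≤ min (hi i) (hi' i) := by
    intro i
    have h := abs_lt.1 (hlt i)
    have h1 := hx i
    have h2 := hy i
    have a1 : lo i ≤ hi i := by exact_mod_cast h1.1.trans h1.2
    have a2 : lo' i ≤ hi' i := by exact_mod_cast h2.1.trans h2.2
    have a3 : lo i < hi' i + 1 := by
      have : (lo i : ℝ) < hi' i + 1 := by linarith
      exact_mod_cast this
    have a4 : lo' i < hi i + 1 := by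
      have : (lo' i : ℝ) < hi i + 1 := by linarith
      exact_mod_cast this
    omega
  refine (Set.disjoint_left.1 hZ :) (hs (a := fun i => max (lo i) (lo' i)) ⟨?_, ?_⟩) (hs' ⟨?_, ?_⟩)
  · exact fun i => le_max_left _ _
  · exact fun i => (key i).trans (min_le_left _ _)
  · exact fun i => le_max_right _ _
  · exact fun i => (key i).trans (min_le_right _ _)

theorem InCell.not_disjoint {x : ι → ℝ} {Z Z' : Set (ι → ℤ)} (hx : InCell x Z)
    (hx' : InCell x Z') : ¬ Disjoint Z Z' := by
  intro h
  obtain ⟨i, hi⟩ := hx.exists_one_le hx' h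
  norm_num at hi

theorem InCell.mem_Icc {x : ι → ℝ} {lo hi : ι → ℤ} (hx : InCell x (Set.Icc lo hi)) (i : ι) :
    (lo i : ℝ) ≤ x i ∧ x i ≤ hi i := by
  obtain ⟨a, b, hab, hs⟩ := hx
  have hle : a ≤ b := fun i => by exact_mod_cast (hab i).1.trans (hab i).2
  have h1 := (hs (Set.left_mem_Icc.2 hle)).1 i
  have h2 := (hs (Set.right_mem_Icc.2 hle)).2 i
  exact ⟨(Int.cast_le.2 h1).trans (hab i).1, (hab i).2.trans (Int.cast_le.2 h2)⟩

/-! ### Lattice paths -/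

/-- The point with parameter `θ` on the straight segment between two lattice points. -/
def seg (a b : ι → ℤ) (θ : ℝ) : ι → ℝ := fun i => a i + θ * (b i - a i)

theorem seg_zero (a b : ι → ℤ) : seg a b 0 = fun i => (a i : ℝ) := by
  ext i; simp [seg]

theorem seg_mem_box {a b lo hi : ι → ℤ} (ha : a ∈ Set.Icc lo hi) (hb : b ∈ Set.Icc lo hi) {θ : ℝ}
    (h0 : 0 ≤ θ) (h1 : θ ≤ 1) : InCell (seg a b θ) (Set.Icc lo hi) := by
  refine ⟨lo, hi, fun i => ?_, le_rfl⟩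
  have a1 : (lo i : ℝ) ≤ a i := by exact_mod_cast ha.1 i
  have a2 : (a i : ℝ) ≤ hi i := by exact_mod_cast ha.2 i
  have b1 : (lo i : ℝ) ≤ b i := by exact_mod_cast hb.1 i
  have b2 : (b i : ℝ) ≤ hi i := by exact_mod_cast hb.2 i
  simp only [seg]
  constructor <;> nlinarith

/-- The graph on `ℤ^ι` in which two points are adjacent when they are at `ℓ¹`-distance one. -/
def latticeGraph (ι : Type*) : SimpleGraph (ι → ℤ) where
  Adj a b := ∃ j, |a j - b j| = 1 ∧ ∀ i ≠ j, a i = b i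
  symm := ⟨fun a b ⟨j, h1, h2⟩ => ⟨j, by rw [abs_sub_comm, h1], fun i hi => (h2 i hi).symm⟩⟩
  loopless := ⟨fun a ⟨j, h1, _⟩ => by simp at h1⟩

theorem inCell_seg_of_adj {a b : ι → ℤ} (h : (latticeGraph ι).Adj a b) {θ : ℝ} (h0 : 0 ≤ θ)
    (h1 : θ ≤ 1) : InCell (seg a b θ) {a, b} := by
  refine (seg_mem_box (lo := a ⊓ b) (hi := a ⊔ b) (by simp) (by simp) h0 h1).mono ?_
  obtain ⟨j, hj, hne⟩ := h
  rintro z ⟨hz1, hz2⟩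
  have hz : ∀ i, min (a i) (b i) ≤ z i ∧ z i ≤ max (a i) (b i) := fun i => ⟨hz1 i, hz2 i⟩
  have hi : ∀ i ≠ j, z i = a i := fun i hij => by
    have := hz i
    rw [hne i hij, min_self, max_self] at this
    rw [hne i hij]
    omega
  have hj' := hz j
  rcases abs_eq (zero_le_one) |>.1 hj with h | h
  · rcases (by omega : z j = a j ∨ z j = b j) with e | e
    · left
      ext i
      by_cases hij : i = j
      · subst hij; exact e
      · exact hi i hij
    · right
      ext i
      by_cases hij : i = j
      · subst hij; exact e
      · rw [hi i hij, hne i hij]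
  · rcases (by omega : z j = a j ∨ z j = b j) with e | e
    · left
      ext i
      by_cases hij : i = j
      · subst hij; exact e
      · exact hi i hij
    · right
      ext i
      by_cases hij : i = j
      · subst hij; exact e
      · rw [hi i hij, hne i hij]

theorem seg_injective {a b : ι → ℤ} (h : a ≠ b) : Function.Injective (seg a b) := by
  intro θ θ' e
  obtain ⟨i, hi⟩ := Function.ne_iff.1 h
  have := congrFun e i
  simp only [seg, add_right_inj] at this
  refine mul_right_cancel₀ (sub_ne_zero.2 ?_) this
  exact_mod_cast hi.symm

/-- Two consecutive edges of a lattice path without backtracking meet only in their common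
vertex. -/
theorem seg_eq_seg_of_adj {a b d : ι → ℤ} (h : (latticeGraph ι).Adj a b)
    (h' : (latticeGraph ι).Adj b d) (had : a ≠ d) {θ θ' : ℝ} (h1 : θ ≤ 1)
    (h0' : 0 ≤ θ') (e : seg a b θ = seg b d θ') : θ = 1 ∧ θ' = 0 := by
  obtain ⟨j, hj, hne⟩ := h
  obtain ⟨j', hj', hne'⟩ := h'
  have ej := congrFun e j
  have ej' := congrFun e j'
  simp only [seg] at ej ej'
  by_cases hjj : j = j'
  · subst hjj
    have hs : b j - a j = d j - b j := by
      by_contra hcon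
      apply had
      ext i
      by_cases hij : i = j
      · subst hij
        rcases abs_eq zero_le_one |>.1 hj with h | h <;>
          rcases abs_eq zero_le_one |>.1 hj' with h' | h' <;> omega
      · rw [hne i hij, hne' i hij]
    have hs' : (b j : ℝ) - a j = d j - b j := by exact_mod_cast hs
    rw [← hs'] at ej
    have : ((b j : ℝ) - a j) * (1 - θ + θ') = 0 := by linarith
    have hnz : (b j : ℝ) - a j ≠ 0 := by
      have : b j - a j ≠ 0 := by
        intro h0
        rw [abs_sub_comm, h0] at hj
        simp at hj
      exact_mod_cast this
    have := (mul_eq_zero.1 this).resolve_left hnz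
    constructor <;> linarith
  · rw [← hne' j hjj] at ej
    rw [hne j' (Ne.symm hjj)] at ej'
    have hnz : (b j : ℝ) - a j ≠ 0 := by
      have : b j - a j ≠ 0 := by
        intro h0
        rw [abs_sub_comm, h0] at hj
        simp at hj
      exact_mod_cast this
    have hnz' : (d j' : ℝ) - b j' ≠ 0 := by
      have : d j' - b j' ≠ 0 := by
        intro h0
        rw [abs_sub_comm, h0] at hj'
        simp at hj'
      exact_mod_cast this
    constructor
    · refine mul_right_cancel₀ hnz ?_
      linarith
    · exact (mul_eq_zero.1 (by linarith : θ' * ((d j' : ℝ) - b j') = 0)).resolve_right hnz'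

/-- The two lattice points are joined by a lattice path inside `S`. -/
def LatticeJoined (S : Set (ι → ℤ)) (a b : ι → ℤ) : Prop :=
  ∃ (ha : a ∈ S) (hb : b ∈ S), ((latticeGraph ι).induce S).Reachable ⟨a, ha⟩ ⟨b, hb⟩

namespace LatticeJoined

variable {S : Set (ι → ℤ)} {a b c : ι → ℤ}

theorem refl (ha : a ∈ S) : LatticeJoined S a a := ⟨ha, ha, .refl _⟩

theorem symm (h : LatticeJoined S a b) : LatticeJoined S b a :=
  let ⟨ha, hb, h⟩ := h
  ⟨hb, ha, h.symm⟩

theorem trans (h : LatticeJoined S a b) (h' : LatticeJoined S b c) : LatticeJoined S a c :=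
  let ⟨ha, _, h⟩ := h
  let ⟨_, hc, h'⟩ := h'
  ⟨ha, hc, h.trans h'⟩

theorem of_adj (ha : a ∈ S) (hb : b ∈ S) (h : (latticeGraph ι).Adj a b) : LatticeJoined S a b :=
  ⟨ha, hb, SimpleGraph.Adj.reachable h⟩

theorem of_nat [DecidableEq ι] (j : ι) (n : ℕ)
    (h : ∀ m : ℕ, m ≤ n → Function.update a j (a j + m) ∈ S) :
    LatticeJoined S a (Function.update a j (a j + n)) := by
  induction n with
  | zero =>
    have := h 0 le_rfl
    simp only [Nat.cast_zero, add_zero, Function.update_eq_self] at this ⊢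
    exact refl this
  | succ n ih =>
    refine (ih fun m hm => h m (by omega)).trans
      (of_adj (h n (by omega)) (h (n + 1) le_rfl) ⟨j, ?_, fun i hi => ?_⟩)
    · simp
    · simp [hi]

/-- Two lattice points which differ in one coordinate only are joined by the segment between
them. -/
theorem of_segment (j : ι) (hne : ∀ i ≠ j, a i = b i)
    (h : ∀ x : ι → ℤ, (∀ i ≠ j, x i = a i) → min (a j) (b j) ≤ x j → x j ≤ max (a j) (b j) →
      x ∈ S) : LatticeJoined S a b := by
  classical
  have aux : ∀ a b : ι → ℤ, a j ≤ b j → (∀ i ≠ j, a i = b i) →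
      (∀ x : ι → ℤ, (∀ i ≠ j, x i = a i) → a j ≤ x j → x j ≤ b j → x ∈ S) →
      LatticeJoined S a b := by
    intro a b hab hne h
    have hb : b = Function.update a j (a j + ((b j - a j).toNat : ℕ)) := by
      ext i
      by_cases hij : i = j
      · subst hij
        simp [hab]
      · simp [hij, hne i hij]
    rw [hb]
    refine of_nat j _ fun m hm => h _ (fun i hi => by simp [hi]) ?_ ?_
    · simp
    · simp only [Function.update_self]
      omega
  rcases le_total (a j) (b j) with hab | hab
  · refine aux a b hab hne fun x hx h1 h2 => h x hx ?_ ?_ <;> simp [*]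
  · refine (aux b a hab (fun i hi => (hne i hi).symm) fun x hx h1 h2 => h x ?_ ?_ ?_).symm
    · exact fun i hi => (hx i hi).trans (hne i hi).symm
    · simp [*]
    · simp [*]

/-- Joined points are joined by a self-avoiding lattice path. -/
theorem exists_path (h : LatticeJoined S a b) : ∃ (n : ℕ) (c : ℕ → ι → ℤ), c 0 = a ∧ c n = b ∧
    (∀ i, c i ∈ S) ∧ (∀ i < n, (latticeGraph ι).Adj (c i) (c (i + 1))) ∧
    Set.InjOn c {i | i ≤ n} := by
  obtain ⟨ha, hb, hr⟩ := h
  obtain ⟨p, hp⟩ := hr.exists_isPath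
  refine ⟨p.length, fun i => (p.getVert i).1, by simp, by simp, fun i => (p.getVert i).2,
    fun i hi => p.adj_getVert_succ hi, fun i hi j hj e => hp.getVert_injOn hi hj (Subtype.ext e)⟩

end LatticeJoined

/-- Distinct parameters of a self-avoiding lattice path give distinct points. -/
theorem seg_path_injective {n : ℕ} {c : ℕ → ι → ℤ}
    (hadj : ∀ i < n, (latticeGraph ι).Adj (c i) (c (i + 1))) (hinj : Set.InjOn c {i | i ≤ n})
    {i j : ℕ} (hi : i < n) (hj : j < n) {θ θ' : ℝ} (h0 : 0 ≤ θ) (h1 : θ ≤ 1) (h0' : 0 ≤ θ')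
    (h1' : θ' ≤ 1) (e : seg (c i) (c (i + 1)) θ = seg (c j) (c (j + 1)) θ') :
    (i : ℝ) + θ = j + θ' := by
  wlog hij : i ≤ j generalizing i j θ θ'
  · exact (this hj hi h0' h1' h0 h1 e.symm (by omega)).symm
  have hneq : ∀ {p q : ℕ}, p ≤ n → q ≤ n → p ≠ q → c p ≠ c q := fun hp hq hpq he =>
    hpq (hinj hp hq he)
  rcases (by omega : i = j ∨ j = i + 1 ∨ i + 2 ≤ j) with rfl | rfl | hlt
  · rw [seg_injective (hneq (by omega) (by omega) (by omega)) e]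
  · obtain ⟨rfl, rfl⟩ := seg_eq_seg_of_adj (hadj i hi) (hadj (i + 1) hj)
      (hneq (by omega) (by omega) (by omega)) h1 h0' e
    push_cast
    ring
  · exfalso
    have hc := inCell_seg_of_adj (hadj i hi) h0 h1
    have hc' := inCell_seg_of_adj (hadj j hj) h0' h1'
    rw [e] at hc
    refine hc.not_disjoint hc' ?_
    rw [Set.disjoint_left]
    rintro z (rfl | rfl) (h | h) <;>
      exact hneq (by omega) (by omega) (by omega) h

/-! ### Polygonal lines -/

/-- The polygonal line with corners `c 0, …, c n`, parametrised by `[0, n]`; the truncation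
`max 0 (min 1 (s - i))` is the part of the `i`-th segment that is covered at time `s`. -/
def polyline (c : ℕ → ι → ℤ) (n : ℕ) (s : ℝ) : ι → ℝ := fun j =>
  c 0 j + ∑ i ∈ Finset.range n, max 0 (min 1 (s - i)) * (c (i + 1) j - c i j)

theorem continuous_polyline (c : ℕ → ι → ℤ) (n : ℕ) : Continuous (polyline c n) := by
  unfold polyline
  fun_prop

theorem polyline_succ (c : ℕ → ι → ℤ) (n : ℕ) (s : ℝ) (j : ι) :
    polyline c (n + 1) s j = polyline c n s j + max 0 (min 1 (s - n)) * (c (n + 1) j - c n j) := by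
  simp only [polyline, Finset.sum_range_succ]
  ring

theorem polyline_of_le (c : ℕ → ι → ℤ) (n : ℕ) {s : ℝ} (h : n ≤ s) (j : ι) :
    polyline c n s j = c n j := by
  induction n with
  | zero => simp [polyline]
  | succ n ih =>
    push_cast at h
    rw [polyline_succ, ih (by linarith), min_eq_left (by linarith), max_eq_right zero_le_one]
    ring

theorem polyline_eq_seg (c : ℕ → ι → ℤ) {n i : ℕ} (hi : i < n) {θ : ℝ} (h0 : 0 ≤ θ) (h1 : θ ≤ 1) :
    polyline c n (i + θ) = seg (c i) (c (i + 1)) θ := by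
  ext j
  induction n, hi using Nat.le_induction with
  | base =>
    rw [polyline_succ, polyline_of_le c i (by linarith), seg, add_sub_cancel_left,
      min_eq_right h1, max_eq_right h0]
  | succ n hn ih =>
    have : ((i.succ : ℕ) : ℝ) ≤ n := by exact_mod_cast hn
    push_cast at this
    rw [polyline_succ, ih, max_eq_left ((min_le_right _ _).trans (by linarith))]
    ring

/-- Each time in `[0, n]` lies in one of the unit intervals. -/
theorem exists_nat_add {n : ℕ} (hn : 0 < n) {s : ℝ} (h0 : 0 ≤ s) (h1 : s ≤ n) :
    ∃ i < n, ∃ θ : ℝ, 0 ≤ θ ∧ θ ≤ 1 ∧ s = i + θ := by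
  rcases h1.lt_or_eq with h | rfl
  · refine ⟨⌊s⌋₊, (Nat.floor_lt h0).2 h, s - ⌊s⌋₊, ?_, ?_, by ring⟩
    · linarith [Nat.floor_le h0]
    · linarith [Nat.lt_floor_add_one s]
  · refine ⟨n - 1, by omega, 1, zero_le_one, le_rfl, ?_⟩
    rw [Nat.cast_sub hn]
    simp

end Lattice

/-! ### Routing in the grid -/

/-- A greedy choice: if, whatever the others have chosen, fewer than `|Ω|` options of each element
are blocked, then options can be chosen without any conflict. -/
theorem exists_forall_not_conflict {E Ω : Type*} [Finite E] [Fintype Ω] [Nonempty Ω]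
    (B : E → E → Ω → Ω → Prop) (hsymm : ∀ e e' x y, B e e' x y → B e' e y x)
    (hB : ∀ (e : E) (φ : E → Ω), ∃ S : Finset Ω, S.card < Fintype.card Ω ∧
      ∀ x e', B e e' x (φ e') → x ∈ S) :
    ∃ φ : E → Ω, ∀ e e', e ≠ e' → ¬ B e e' (φ e) (φ e') := by
  classical
  have := Fintype.ofFinite E
  have hfree : ∀ (e : E) (φ : E → Ω), ∃ x, ∀ e', ¬ B e e' x (φ e') := by
    intro e φ
    obtain ⟨S, hS, h⟩ := hB e φ
    obtain ⟨x, hx⟩ : ∃ x, x ∉ S := by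
      by_contra! hall
      rw [Finset.eq_univ_of_forall hall, Finset.card_univ] at hS
      exact hS.false
    exact ⟨x, fun e' he' => hx (h x e' he')⟩
  have key : ∀ s : Finset E, ∃ φ : E → Ω, ∀ e ∈ s, ∀ e' ∈ s, e ≠ e' → ¬ B e e' (φ e) (φ e') := by
    intro s
    induction s using Finset.induction_on with
    | empty => exact ⟨fun _ => Classical.arbitrary Ω, by simp⟩
    | insert a s ha ih =>
      obtain ⟨φ, hφ⟩ := ih
      obtain ⟨x, hx⟩ := hfree a φ
      refine ⟨Function.update φ a x, ?_⟩
      have hs : ∀ e ∈ s, Function.update φ a x e = φ e := fun e he =>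
        Function.update_of_ne (fun h : e = a => ha (h ▸ he)) _ _
      intro e he e' he' hee
      rcases Finset.mem_insert.1 he with h | h <;> rcases Finset.mem_insert.1 he' with h' | h'
      · exact absurd (h.trans h'.symm) hee
      · rw [h, Function.update_self, hs e' h']
        exact hx e'
      · rw [h', Function.update_self, hs e h]
        exact fun h => hx e (hsymm _ _ _ _ h)
      · rw [hs e h, hs e' h']
        exact hφ e h e' h' hee
  obtain ⟨φ, hφ⟩ := key Finset.univ
  exact ⟨φ, fun e e' => hφ e (Finset.mem_univ e) e' (Finset.mem_univ e')⟩

/-- Two families `P false` and `P true` of pairwise distinct points of the grid `[M]^k` are joined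
through intermediate points `w e` on levels `t e`, changing the coordinates one after the other.
On the way between `P b e` and `w e` the `j`-th coordinate is changed on the line that is given by
the coordinates of `w e` before `j` and those of `P b e` after `j`. The choice is such that no two
of these lines on a common level coincide: for each of the `2k` pairs `(b, j)`, at most
`M ^ (k + 1)` of the options for an element `e` are blocked. -/
theorem exists_routing {E : Type*} [Finite E] (k M : ℕ) (P : Bool → E → Fin k → Fin M)
    (hP : ∀ b, Function.Injective (P b)) :
    ∃ (w : E → Fin k → Fin M) (t : E → Fin (2 * k * M + 1)), ∀ e e', e ≠ e' → t e = t e' →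
      ∀ b j, (∀ i < j, w e i = w e' i) → ¬ ∀ i, j < i → P b e i = P b e' i := by
  classical
  rcases isEmpty_or_nonempty E with hE | ⟨⟨e₀⟩⟩
  · exact ⟨fun e => (hE.false e).elim, fun e => (hE.false e).elim, fun e => (hE.false e).elim⟩
  have hne : Nonempty (Fin k → Fin M) := ⟨P true e₀⟩
  let Ω := (Fin k → Fin M) × Fin (2 * k * M + 1)
  let B : E → E → Ω → Ω → Prop := fun e e' x y =>
    x.2 = y.2 ∧ ∃ b j, (∀ i < j, x.1 i = y.1 i) ∧ ∀ i, j < i → P b e i = P b e' i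
  suffices hB : ∀ (e : E) (φ : E → Ω), ∃ S : Finset Ω, S.card < Fintype.card Ω ∧
      ∀ x e', B e e' x (φ e') → x ∈ S by
    obtain ⟨φ, hφ⟩ := exists_forall_not_conflict B (fun e e' x y ⟨h, b, j, h1, h2⟩ =>
      ⟨h.symm, b, j, fun i hi => (h1 i hi).symm, fun i hi => (h2 i hi).symm⟩) hB
    exact ⟨fun e => (φ e).1, fun e => (φ e).2, fun e e' hee ht b j h1 h2 =>
      hφ e e' hee ⟨ht, b, j, h1, h2⟩⟩
  intro e φ
  -- A blocking element `e'` is determined by `P b e'`, of which the coordinates after `j` are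
  -- known; the remaining `j` coordinates of `P b e'` and the `k - j` free coordinates of the option
  -- are stored together in `x`, and the `j`-th coordinate of `P b e'` in `m`.
  let Q : Bool × Fin k × (Fin k → Fin M) × Fin M → Fin k → Fin M := fun ⟨b, j, x, m⟩ i =>
    if i < j then x i else if i = j then m else P b e i
  let F : Bool × Fin k × (Fin k → Fin M) × Fin M → Ω := fun a =>
    if h : ∃ e', P a.1 e' = Q a then
      (fun i => if i < a.2.1 then (φ h.choose).1 i else a.2.2.1 i, (φ h.choose).2)
    else Classical.arbitrary Ω
  refine ⟨Finset.univ.image F, ?_, ?_⟩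
  · refine Finset.card_image_le.trans_lt ?_
    have hpos : 0 < M ^ k := by
      have := Fintype.card_pos (α := Fin k → Fin M)
      simpa using this
    simp only [Finset.card_univ, Ω, Fintype.card_prod, Fintype.card_bool, Fintype.card_fin,
      Fintype.card_fun]
    calc 2 * (k * (M ^ k * M)) = M ^ k * (2 * k * M) := by ring
      _ < M ^ k * (2 * k * M + 1) := Nat.mul_lt_mul_of_pos_left (Nat.lt_succ_self _) hpos
  · rintro ⟨w, t⟩ e' ⟨ht, b, j, h1, h2⟩
    refine Finset.mem_image.2
      ⟨(b, j, fun i => if i < j then P b e' i else w i, P b e' j), Finset.mem_univ _, ?_⟩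
    have hQ : P b e' = Q (b, j, fun i => if i < j then P b e' i else w i, P b e' j) := by
      ext1 i
      simp only [Q]
      split_ifs with hlt heq
      · rfl
      · rw [heq]
      · exact (h2 i (lt_of_le_of_ne (not_lt.1 hlt) (Ne.symm heq))).symm
    have hex : ∃ e'', P b e'' = Q (b, j, fun i => if i < j then P b e' i else w i, P b e' j) :=
      ⟨e', hQ⟩
    have hc : hex.choose = e' := hP b (hex.choose_spec.trans hQ.symm)
    simp only [F]
    rw [dif_pos hex, hc]
    refine Prod.ext ?_ ht.symm
    ext1 i
    simp only
    split_ifs with hlt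
    · exact (h1 i hlt).symm
    · rfl

/-! ### From lattice layouts to maps of the realisation -/

section Realization

variable {V : Type u} (Γ : SimpleGraph V)

/-- The two ends of an edge: `false` is the vertex at which the parameter `0` is glued, and `true`
the one at which the parameter `1` is glued. -/
def edgeEnd (e : Γ.edgeSet) : Bool → V
  | false => (Quot.out e.1).1
  | true => (Quot.out e.1).2

theorem mk_edgeEnd (e : Γ.edgeSet) : s(edgeEnd Γ e false, edgeEnd Γ e true) = e.1 :=
  Quot.out_eq e.1

theorem mem_edge_iff (e : Γ.edgeSet) (v : V) : v ∈ e.1 ↔ ∃ b, v = edgeEnd Γ e b := by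
  conv_lhs => rw [← mk_edgeEnd Γ e]
  rw [Sym2.mem_iff, Bool.exists_bool]

theorem edgeEnd_mem (e : Γ.edgeSet) (b : Bool) : edgeEnd Γ e b ∈ e.1 :=
  (mem_edge_iff Γ e _).2 ⟨b, rfl⟩

theorem edgeEnd_injective (e : Γ.edgeSet) : Function.Injective (edgeEnd Γ e) := by
  have h : Γ.Adj (edgeEnd Γ e false) (edgeEnd Γ e true) := by
    rw [← SimpleGraph.mem_edgeSet, mk_edgeEnd]
    exact e.2
  intro b b' hb
  cases b <;> cases b' <;> first | rfl | exact absurd hb h.ne | exact absurd hb h.ne'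

theorem edgePoint_zero (e : Γ.edgeSet) :
    Realization.edgePoint Γ e 0 = Realization.vertex Γ (edgeEnd Γ e false) :=
  Quot.sound (Glue.source e)

theorem edgePoint_one (e : Γ.edgeSet) :
    Realization.edgePoint Γ e 1 = Realization.vertex Γ (edgeEnd Γ e true) :=
  Quot.sound (Glue.target e)

variable {Γ} in
theorem Realization.cases (x : Realization Γ) :
    (∃ v, x = Realization.vertex Γ v) ∨ ∃ e t, x = Realization.edgePoint Γ e t := by
  induction x using Quot.ind with
  | mk a =>
    rcases a with ⟨v, _⟩ | ⟨e, t⟩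
    · exact .inl ⟨v, rfl⟩
    · exact .inr ⟨e, t, rfl⟩

instance [Finite V] : CompactSpace (Realization Γ) :=
  inferInstanceAs (CompactSpace (Quot (Glue Γ)))

end Realization

/-- The lattice data from which an embedding of the realisation of `Γ` is built. Each vertex `v`
has an integer box and, in it, a centre on the level `0` of the coordinate `τ`. Each edge has a
port on the level `1` in the boxes of its two ends. The ports of an edge are joined by a
lattice path in a set `route e`, which does not go below the level `1`; these sets are pairwise
disjoint. The image of an edge will consist of the straight segments between the ports and the
centres and of the lattice path between the ports. -/
structure Layout {V : Type u} (Γ : SimpleGraph V) (ι : Type v) (τ : ι) where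
  lo : V → ι → ℤ
  hi : V → ι → ℤ
  center : V → ι → ℤ
  port : Γ.edgeSet → Bool → ι → ℤ
  route : Γ.edgeSet → Set (ι → ℤ)
  center_mem : ∀ v, center v ∈ Set.Icc (lo v) (hi v)
  center_level : ∀ v, center v τ = 0
  box_disjoint : ∀ v w, v ≠ w → Disjoint (Set.Icc (lo v) (hi v)) (Set.Icc (lo w) (hi w))
  port_mem : ∀ e b, port e b ∈ Set.Icc (lo (edgeEnd Γ e b)) (hi (edgeEnd Γ e b))
  port_level : ∀ e b, port e b τ = 1
  route_level : ∀ e, ∀ x ∈ route e, 1 ≤ x τ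
  route_joined : ∀ e, LatticeJoined (route e) (port e false) (port e true)
  route_disjoint : ∀ e e', e ≠ e' → Disjoint (route e) (route e')
  route_box_disjoint : ∀ e v, v ∉ e.1 → Disjoint (route e) (Set.Icc (lo v) (hi v))

namespace Layout

variable {V : Type u} {Γ : SimpleGraph V} {ι : Type v} {τ : ι} (D : Layout Γ ι τ)

/-- The box of a vertex. -/
def box (v : V) : Set (ι → ℤ) := Set.Icc (D.lo v) (D.hi v)

theorem port_mem_route (e : Γ.edgeSet) (b : Bool) : D.port e b ∈ D.route e := by
  obtain ⟨h, h', -⟩ := D.route_joined e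
  cases b <;> assumption

/-- The number of steps of the lattice path of an edge. -/
def pathLength (e : Γ.edgeSet) : ℕ := (D.route_joined e).exists_path.choose

/-- The self-avoiding lattice path of an edge. -/
def path (e : Γ.edgeSet) : ℕ → ι → ℤ := (D.route_joined e).exists_path.choose_spec.choose

theorem path_spec (e : Γ.edgeSet) : D.path e 0 = D.port e false ∧
    D.path e (D.pathLength e) = D.port e true ∧ (∀ i, D.path e i ∈ D.route e) ∧
    (∀ i < D.pathLength e, (latticeGraph ι).Adj (D.path e i) (D.path e (i + 1))) ∧
    Set.InjOn (D.path e) {i | i ≤ D.pathLength e} :=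
  (D.route_joined e).exists_path.choose_spec.choose_spec

theorem port_injective (e : Γ.edgeSet) : Function.Injective (D.port e) := by
  intro b b' h
  by_contra hne
  refine Set.disjoint_left.1 (D.box_disjoint _ _ ((edgeEnd_injective Γ e).ne hne)) (D.port_mem e b)
    ?_
  rw [h]
  exact D.port_mem e b'

theorem pathLength_pos (e : Γ.edgeSet) : 0 < D.pathLength e := by
  by_contra h
  have h0 : D.pathLength e = 0 := by omega
  have h1 := (D.path_spec e).2.1
  rw [h0, (D.path_spec e).1] at h1
  exact absurd (D.port_injective e h1) (by simp)

/-- The corners of the polygonal line of an edge: the centre of the first end, the lattice path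
between the ports, and the centre of the second end. -/
def corner (e : Γ.edgeSet) : ℕ → ι → ℤ
  | 0 => D.center (edgeEnd Γ e false)
  | i + 1 => if i ≤ D.pathLength e then D.path e i else D.center (edgeEnd Γ e true)

/-- The polygonal line of an edge, parametrised by `[0, pathLength e + 2]`. -/
def curve (e : Γ.edgeSet) (s : ℝ) : ι → ℝ := polyline (D.corner e) (D.pathLength e + 2) s

/-- The time at which the curve of an edge is at the distance parameter `σ` from its end `b`. -/
def endTime (e : Γ.edgeSet) (σ : ℝ) : Bool → ℝ
  | false => σ
  | true => D.pathLength e + 2 - σ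

theorem curve_zero (e : Γ.edgeSet) :
    D.curve e 0 = fun i => (D.center (edgeEnd Γ e false) i : ℝ) := by
  have h := polyline_eq_seg (D.corner e) (n := D.pathLength e + 2) (i := 0) (by omega)
    le_rfl zero_le_one
  rw [seg_zero] at h
  simpa [curve, corner] using h

theorem curve_end (e : Γ.edgeSet) :
    D.curve e (D.pathLength e + 2) = fun i => (D.center (edgeEnd Γ e true) i : ℝ) := by
  ext j
  have h := polyline_of_le (D.corner e) (D.pathLength e + 2)
    (s := D.pathLength e + 2) (by push_cast; exact le_rfl) j
  simpa [curve, corner] using h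

/-- Each point of the curve of an edge lies either on one of the segments at its ends, on a level
below `1`, or on a step of the lattice path. -/
theorem curve_cases (e : Γ.edgeSet) {s : ℝ} (h0 : 0 ≤ s) (h1 : s ≤ D.pathLength e + 2) :
    (∃ b σ, 0 ≤ σ ∧ σ < 1 ∧ s = D.endTime e σ b ∧
      D.curve e s = seg (D.center (edgeEnd Γ e b)) (D.port e b) σ) ∨
    ∃ i < D.pathLength e, ∃ θ, 0 ≤ θ ∧ θ ≤ 1 ∧ s = i + θ + 1 ∧
      D.curve e s = seg (D.path e i) (D.path e (i + 1)) θ := by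
  obtain ⟨hp0, hp1, -, -, -⟩ := D.path_spec e
  rcases lt_or_ge s 1 with hs | hs
  · refine .inl ⟨false, s, h0, hs, rfl, ?_⟩
    have h := polyline_eq_seg (D.corner e) (n := D.pathLength e + 2) (i := 0) (by omega)
      h0 hs.le
    simpa [curve, corner, hp0] using h
  rcases lt_or_ge (D.pathLength e + 1 : ℝ) s with hs' | hs'
  · refine .inl ⟨true, D.pathLength e + 2 - s, by linarith, by linarith, by simp [endTime], ?_⟩
    have h := polyline_eq_seg (D.corner e) (n := D.pathLength e + 2) (i := D.pathLength e + 1)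
      (by omega) (θ := s - (D.pathLength e + 1)) (by linarith) (by linarith)
    simp only [curve]
    rw [show s = ((D.pathLength e + 1 : ℕ) : ℝ) + (s - (D.pathLength e + 1)) by push_cast; ring, h]
    ext j
    simp only [seg, corner, le_refl, if_true, hp1]
    rw [if_neg (by omega)]
    push_cast
    ring
  · obtain ⟨i, hi, θ, hθ0, hθ1, hθ⟩ := exists_nat_add (D.pathLength_pos e) (s := s - 1)
      (by linarith) (by linarith)
    refine .inr ⟨i, hi, θ, hθ0, hθ1, by linarith, ?_⟩
    have h := polyline_eq_seg (D.corner e) (n := D.pathLength e + 2) (i := i + 1)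
      (by omega) hθ0 hθ1
    simp only [curve]
    rw [show s = ((i + 1 : ℕ) : ℝ) + θ by push_cast; linarith, h]
    simp only [corner]
    rw [if_pos (by omega), if_pos (by omega)]

theorem seg_center_port_level (e : Γ.edgeSet) (b : Bool) (σ : ℝ) :
    seg (D.center (edgeEnd Γ e b)) (D.port e b) σ τ = σ := by
  simp [seg, D.center_level, D.port_level]

theorem inCell_seg_center_port (e : Γ.edgeSet) (b : Bool) {σ : ℝ} (h0 : 0 ≤ σ) (h1 : σ ≤ 1) :
    InCell (seg (D.center (edgeEnd Γ e b)) (D.port e b) σ) (D.box (edgeEnd Γ e b)) :=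
  seg_mem_box (D.center_mem _) (D.port_mem e b) h0 h1

theorem inCell_seg_path (e : Γ.edgeSet) {i : ℕ} (hi : i < D.pathLength e) {θ : ℝ} (h0 : 0 ≤ θ)
    (h1 : θ ≤ 1) : InCell (seg (D.path e i) (D.path e (i + 1)) θ) (D.route e) := by
  obtain ⟨-, -, h, hadj, -⟩ := D.path_spec e
  refine (inCell_seg_of_adj (hadj i hi) h0 h1).mono ?_
  rintro z (rfl | rfl) <;> exact h _

theorem one_le_seg_path_level (e : Γ.edgeSet) {i : ℕ} {θ : ℝ} (h0 : 0 ≤ θ)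
    (h1 : θ ≤ 1) : 1 ≤ seg (D.path e i) (D.path e (i + 1)) θ τ := by
  obtain ⟨-, -, h, -, -⟩ := D.path_spec e
  have h2 : (1 : ℝ) ≤ D.path e i τ := by exact_mod_cast D.route_level e _ (h i)
  have h3 : (1 : ℝ) ≤ D.path e (i + 1) τ := by exact_mod_cast D.route_level e _ (h (i + 1))
  simp only [seg]
  nlinarith

/-- The lattice points that belong to an edge: its route and the boxes of its ends. -/
def zone (e : Γ.edgeSet) : Set (ι → ℤ) := D.route e ∪ ⋃ b, D.box (edgeEnd Γ e b)

theorem inCell_curve (e : Γ.edgeSet) {s : ℝ} (h0 : 0 ≤ s) (h1 : s ≤ D.pathLength e + 2) :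
    InCell (D.curve e s) (D.zone e) := by
  rcases D.curve_cases e h0 h1 with ⟨b, σ, hσ0, hσ1, -, hc⟩ | ⟨i, hi, θ, hθ0, hθ1, -, hc⟩
  · rw [hc]
    exact (D.inCell_seg_center_port e b hσ0 hσ1.le).mono
      ((Set.subset_iUnion (fun b => D.box (edgeEnd Γ e b)) b).trans Set.subset_union_right)
  · rw [hc]
    exact (D.inCell_seg_path e hi hθ0 hθ1).mono Set.subset_union_left

theorem zone_disjoint_box (e : Γ.edgeSet) {v : V} (hv : v ∉ e.1) :
    Disjoint (D.zone e) (D.box v) := by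
  refine Set.disjoint_union_left.2 ⟨D.route_box_disjoint e v hv, Set.disjoint_iUnion_left.2 ?_⟩
  exact fun b => D.box_disjoint _ _ fun h => hv (h ▸ edgeEnd_mem Γ e b)

theorem zone_disjoint_zone {e e' : Γ.edgeSet} (h : ∀ v ∈ e.1, v ∉ e'.1) :
    Disjoint (D.zone e) (D.zone e') := by
  have hne : e ≠ e' := fun he => h _ (edgeEnd_mem Γ e true) (he ▸ edgeEnd_mem Γ e true)
  refine Set.disjoint_union_right.2 ⟨Set.disjoint_union_left.2 ⟨D.route_disjoint e e' hne, ?_⟩,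
    Set.disjoint_iUnion_right.2 fun b =>
      D.zone_disjoint_box e fun hb => h _ hb (edgeEnd_mem Γ e' b)⟩
  exact Set.disjoint_iUnion_left.2 fun b =>
    (D.route_box_disjoint e' _ (h _ (edgeEnd_mem Γ e b))).symm

/-- The map of the realisation that is defined by a layout. -/
def toMap : Realization Γ → ι → ℝ :=
  Quot.lift (Sum.elim (fun v i => (D.center v.1 i : ℝ))
      fun a => D.curve a.1 ((a.2 : ℝ) * (D.pathLength a.1 + 2))) <| by
    rintro _ _ (e | e)
    · simpa [edgeEnd] using D.curve_zero e
    · simpa [edgeEnd] using D.curve_end e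

theorem toMap_vertex (v : V) :
    D.toMap (Realization.vertex Γ v) = fun i => (D.center v i : ℝ) := rfl

theorem toMap_edgePoint (e : Γ.edgeSet) (t : unitInterval) :
    D.toMap (Realization.edgePoint Γ e t) = D.curve e ((t : ℝ) * (D.pathLength e + 2)) := rfl

theorem continuous_toMap : Continuous D.toMap := by
  refine continuous_quot_lift _ (continuous_sum_dom.2 ⟨?_, ?_⟩)
  · exact continuous_sigma fun v => by simpa using continuous_const
  · refine continuous_sigma fun e => ?_
    have h : Continuous fun t : unitInterval => (t : ℝ) * (D.pathLength e + 2) := by fun_prop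
    exact (continuous_polyline (D.corner e) (D.pathLength e + 2)).comp h

theorem time_mem (e : Γ.edgeSet) (t : unitInterval) :
    0 ≤ (t : ℝ) * (D.pathLength e + 2) ∧
      (t : ℝ) * (D.pathLength e + 2) ≤ D.pathLength e + 2 := by
  have h := t.2
  constructor
  · exact mul_nonneg h.1 (by positivity)
  · exact mul_le_of_le_one_left (by positivity) h.2

theorem inCell_toMap_vertex (v : V) : InCell (D.toMap (Realization.vertex Γ v)) (D.box v) :=
  inCell_intCast (D.center_mem v)

theorem inCell_toMap_edgePoint (e : Γ.edgeSet) (t : unitInterval) :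
    InCell (D.toMap (Realization.edgePoint Γ e t)) (D.zone e) :=
  D.inCell_curve e (D.time_mem e t).1 (D.time_mem e t).2

theorem vertex_ne {v w : V} (h : v ≠ w) : ∃ i, 1 ≤
    |D.toMap (Realization.vertex Γ v) i - D.toMap (Realization.vertex Γ w) i| :=
  (D.inCell_toMap_vertex v).exists_one_le (D.inCell_toMap_vertex w) (D.box_disjoint v w h)

theorem edgePoint_vertex {e : Γ.edgeSet} {v : V} (h : v ∉ e.1) (t : unitInterval) : ∃ i, 1 ≤
    |D.toMap (Realization.edgePoint Γ e t) i - D.toMap (Realization.vertex Γ v) i| :=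
  (D.inCell_toMap_edgePoint e t).exists_one_le (D.inCell_toMap_vertex v) (D.zone_disjoint_box e h)

theorem edgePoint_edgePoint {e e' : Γ.edgeSet} (h : ∀ v ∈ e.1, v ∉ e'.1) (s t : unitInterval) :
    ∃ i, 1 ≤
      |D.toMap (Realization.edgePoint Γ e s) i - D.toMap (Realization.edgePoint Γ e' t) i| :=
  (D.inCell_toMap_edgePoint e s).exists_one_le (D.inCell_toMap_edgePoint e' t)
    (D.zone_disjoint_zone h)

theorem eq_of_endTime_zero {e : Γ.edgeSet} {t : unitInterval} {b : Bool}
    (h : (t : ℝ) * (D.pathLength e + 2) = D.endTime e 0 b) :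
    Realization.edgePoint Γ e t = Realization.vertex Γ (edgeEnd Γ e b) := by
  have hpos : (0 : ℝ) < D.pathLength e + 2 := by positivity
  cases b
  · have : t = 0 := Subtype.ext ((mul_eq_zero.1 h).resolve_right hpos.ne')
    rw [this, edgePoint_zero]
  · have : t = 1 := Subtype.ext (mul_right_cancel₀ hpos.ne' (by simpa [endTime] using h))
    rw [this, edgePoint_one]

theorem vertex_injective {v w : V}
    (h : D.toMap (Realization.vertex Γ v) = D.toMap (Realization.vertex Γ w)) : v = w := by
  by_contra hne
  obtain ⟨i, hi⟩ := D.vertex_ne hne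
  rw [h] at hi
  norm_num at hi

theorem edgePoint_eq_vertex {e : Γ.edgeSet} {t : unitInterval} {v : V}
    (h : D.toMap (Realization.edgePoint Γ e t) = D.toMap (Realization.vertex Γ v)) :
    Realization.edgePoint Γ e t = Realization.vertex Γ v := by
  have hτ : D.toMap (Realization.edgePoint Γ e t) τ = 0 := by
    rw [h, toMap_vertex]
    simp [D.center_level]
  rw [toMap_edgePoint] at hτ
  rcases D.curve_cases e (D.time_mem e t).1 (D.time_mem e t).2 with
    ⟨b, σ, hσ0, hσ1, hs, hc⟩ | ⟨i, hi, θ, hθ0, hθ1, -, hc⟩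
  · rw [hc, seg_center_port_level] at hτ
    subst hτ
    have he := D.eq_of_endTime_zero hs
    rw [he] at h ⊢
    rw [D.vertex_injective h]
  · have := D.one_le_seg_path_level e (i := i) hθ0 hθ1
    rw [← hc] at this
    linarith

theorem edgePoint_injective {e e' : Γ.edgeSet} {t t' : unitInterval}
    (h : D.toMap (Realization.edgePoint Γ e t) = D.toMap (Realization.edgePoint Γ e' t')) :
    Realization.edgePoint Γ e t = Realization.edgePoint Γ e' t' := by
  have hpos : (0 : ℝ) < D.pathLength e + 2 := by positivity
  simp only [toMap_edgePoint] at h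
  rcases D.curve_cases e (D.time_mem e t).1 (D.time_mem e t).2 with
    ⟨b, σ, hσ0, hσ1, hs, hc⟩ | ⟨i, hi, θ, hθ0, hθ1, hs, hc⟩ <;>
  rcases D.curve_cases e' (D.time_mem e' t').1 (D.time_mem e' t').2 with
    ⟨b', σ', hσ0', hσ1', hs', hc'⟩ | ⟨i', hi', θ', hθ0', hθ1', hs', hc'⟩
  all_goals rw [hc, hc'] at h
  · have hσ : σ = σ' := by
      have := congrFun h τ
      rwa [seg_center_port_level, seg_center_port_level] at this
    subst hσ
    have hv : edgeEnd Γ e b = edgeEnd Γ e' b' := by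
      by_contra hne
      have h2 := D.inCell_seg_center_port e' b' hσ0' hσ1'.le
      rw [← h] at h2
      exact (D.inCell_seg_center_port e b hσ0 hσ1.le).not_disjoint h2 (D.box_disjoint _ _ hne)
    rcases hσ0.eq_or_lt with rfl | hσ
    · rw [D.eq_of_endTime_zero hs, D.eq_of_endTime_zero hs', hv]
    · have hport : D.port e b = D.port e' b' := by
        ext j
        have := congrFun h j
        simp only [seg, hv, add_right_inj] at this
        have := mul_left_cancel₀ hσ.ne' this
        have : (D.port e b j : ℝ) = D.port e' b' j := by linarith
        exact_mod_cast this
      have hee : e = e' := by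
        by_contra hne
        refine Set.disjoint_left.1 (D.route_disjoint e e' hne) (D.port_mem_route e b) ?_
        rw [hport]
        exact D.port_mem_route e' b'
      subst hee
      rw [D.port_injective e hport, ← hs'] at hs
      rw [Subtype.ext (mul_right_cancel₀ hpos.ne' hs)]
  · have h1 := D.one_le_seg_path_level e' (i := i') hθ0' hθ1'
    rw [← h, seg_center_port_level] at h1
    linarith
  · have h1 := D.one_le_seg_path_level e (i := i) hθ0 hθ1
    rw [h, seg_center_port_level] at h1
    linarith
  · have hee : e = e' := by
      by_contra hne
      have h2 := D.inCell_seg_path e' hi' hθ0' hθ1'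
      rw [← h] at h2
      exact (D.inCell_seg_path e hi hθ0 hθ1).not_disjoint h2 (D.route_disjoint _ _ hne)
    subst hee
    obtain ⟨-, -, -, hadj, hinj⟩ := D.path_spec e
    have := seg_path_injective hadj hinj hi hi' hθ0 hθ1 hθ0' hθ1' h
    rw [this, ← hs'] at hs
    rw [Subtype.ext (mul_right_cancel₀ hpos.ne' hs)]

theorem injective_toMap : Function.Injective D.toMap := by
  intro x y h
  rcases x.cases with ⟨v, rfl⟩ | ⟨e, t, rfl⟩ <;> rcases y.cases with ⟨w, rfl⟩ | ⟨e', t', rfl⟩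
  · rw [D.vertex_injective h]
  · exact (D.edgePoint_eq_vertex h.symm).symm
  · exact D.edgePoint_eq_vertex h
  · exact D.edgePoint_injective h

/-- If the boxes and the routes lie in an integer box, then so does the image. -/
theorem toMap_mem {A B : ι → ℤ} (hbox : ∀ v, D.box v ⊆ Set.Icc A B)
    (hroute : ∀ e, D.route e ⊆ Set.Icc A B) (x : Realization Γ) (i : ι) :
    (A i : ℝ) ≤ D.toMap x i ∧ D.toMap x i ≤ B i := by
  rcases x.cases with ⟨v, rfl⟩ | ⟨e, t, rfl⟩
  · exact ((D.inCell_toMap_vertex v).mono (hbox v)).mem_Icc i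
  · exact ((D.inCell_toMap_edgePoint e t).mono
      (Set.union_subset (hroute e) (Set.iUnion_subset fun b => hbox _))).mem_Icc i

end Layout

/-! ### Boxes in `ℝ^r × ℍ^q` -/

section Hyperbolic

variable {q : ℕ}

/-- The point of the half-space whose coordinates are those of `x` multiplied by `lam`, except that
the last coordinate of `x` is the logarithm of the height. -/
def halfSpacePoint (lam : ℝ) (x : Fin q → ℝ) : EuclideanSpace ℝ (Fin q) :=
  WithLp.toLp 2 fun i => if (i : ℕ) + 1 = q then Real.exp (x i) else lam * x i

theorem height_halfSpacePoint_succ {n : ℕ} (lam : ℝ) (x : Fin (n + 1) → ℝ) :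
    height (halfSpacePoint lam x) = Real.exp (x (Fin.last n)) := by
  simp [height, halfSpacePoint]

theorem height_halfSpacePoint_pos (lam : ℝ) (x : Fin q → ℝ) :
    0 < height (halfSpacePoint lam x) := by
  cases q with
  | zero => exact one_pos
  | succ n => rw [height_halfSpacePoint_succ]; exact Real.exp_pos _

/-- The map `halfSpacePoint` as a map to hyperbolic space. -/
def toHyperbolic (lam : ℝ) (x : Fin q → ℝ) : HyperbolicSpace q :=
  ⟨halfSpacePoint lam x, height_halfSpacePoint_pos lam x⟩

theorem continuous_toHyperbolic (lam : ℝ) : Continuous (toHyperbolic (q := q) lam) := by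
  refine Continuous.subtype_mk ((PiLp.continuous_toLp 2 _).comp (continuous_pi fun i => ?_)) _
  split_ifs <;> fun_prop

theorem toHyperbolic_injective {lam : ℝ} (h : lam ≠ 0) :
    Function.Injective (toHyperbolic (q := q) lam) := by
  intro x y hxy
  have h1 : halfSpacePoint lam x = halfSpacePoint lam y := congrArg Subtype.val hxy
  ext i
  have h2 := congrArg (fun z : EuclideanSpace ℝ (Fin q) => z i) h1
  simp only [halfSpacePoint] at h2
  split_ifs at h2 with hi
  · exact Real.exp_injective h2
  · exact mul_left_cancel₀ h h2

theorem height_halfSpacePoint_mem {lam H : ℝ} (hH : 0 ≤ H) {x : Fin q → ℝ} (h0 : ∀ i, 0 ≤ x i)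
    (h1 : ∀ i : Fin q, (i : ℕ) + 1 = q → x i ≤ H) :
    1 ≤ height (halfSpacePoint lam x) ∧ height (halfSpacePoint lam x) ≤ Real.exp H := by
  cases q with
  | zero => exact ⟨le_rfl, Real.one_le_exp hH⟩
  | succ n =>
    rw [height_halfSpacePoint_succ]
    exact ⟨Real.one_le_exp (h0 _), Real.exp_le_exp.2 (h1 _ (by simp))⟩

theorem cosh_one_le : Real.cosh 1 ≤ 3 := by
  rw [Real.cosh_eq]
  have h1 := Real.exp_one_lt_d9
  have h2 : Real.exp (-1) ≤ 1 := Real.exp_le_one_iff.2 (by norm_num)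
  linarith

theorem cosh_two_le : Real.cosh 2 ≤ 5 := by
  rw [Real.cosh_eq]
  have h1 := Real.exp_one_lt_d9
  have h2 : Real.exp (-2) ≤ 1 := Real.exp_le_one_iff.2 (by norm_num)
  have h3 : Real.exp 2 = Real.exp 1 * Real.exp 1 := by rw [← Real.exp_add]; norm_num
  have h4 := Real.exp_pos 1
  nlinarith

/-- Coordinates that differ by at least `1` give points at hyperbolic distance at least `1`. -/
theorem one_le_dist_toHyperbolic {H : ℝ} {x y : Fin q → ℝ}
    (hx0 : ∀ i, 0 ≤ x i) (hy0 : ∀ i, 0 ≤ y i) (hx1 : ∀ i : Fin q, (i : ℕ) + 1 = q → x i ≤ H)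
    (hy1 : ∀ i : Fin q, (i : ℕ) + 1 = q → y i ≤ H) (i : Fin q) (hi : 1 ≤ |x i - y i|) :
    1 ≤ dist (toHyperbolic (2 * Real.exp H) x) (toHyperbolic (2 * Real.exp H) y) := by
  obtain ⟨n, rfl⟩ : ∃ n, q = n + 1 := ⟨q - 1, by have := i.2; omega⟩
  have hH : 0 ≤ H := (hx0 (Fin.last n)).trans (hx1 _ (by simp))
  have hxh := height_halfSpacePoint_mem (lam := 2 * Real.exp H) hH hx0 hx1
  have hyh := height_halfSpacePoint_mem (lam := 2 * Real.exp H) hH hy0 hy1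
  set X := toHyperbolic (2 * Real.exp H) x with hX
  set Y := toHyperbolic (2 * Real.exp H) y with hY
  have hXv : X.1 = halfSpacePoint (2 * Real.exp H) x := rfl
  have hYv : Y.1 = halfSpacePoint (2 * Real.exp H) y := rfl
  have hXp := X.2
  have hYp := Y.2
  have hcoord : |X.1 i - Y.1 i| ≤ ‖X.1 - Y.1‖ := by
    simpa using PiLp.norm_apply_le (X.1 - Y.1) i
  have hd0 : 0 ≤ dist X Y := dist_nonneg
  suffices h : Real.cosh 1 ≤ Real.cosh (dist X Y) by
    rw [Real.cosh_le_cosh, abs_of_nonneg hd0] at h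
    simpa using h
  rw [HyperbolicSpace.cosh_dist]
  have hsq : (X.1 i - Y.1 i) ^ 2 ≤ ‖X.1 - Y.1‖ ^ 2 := by
    rw [← sq_abs]
    gcongr
  by_cases hil : (i : ℕ) + 1 = n + 1
  · have hi' : i = Fin.last n := Fin.ext (by simpa using hil)
    subst hi'
    have e1 : X.1 (Fin.last n) = Real.exp (x (Fin.last n)) := by simp [hXv, halfSpacePoint]
    have e2 : Y.1 (Fin.last n) = Real.exp (y (Fin.last n)) := by simp [hYv, halfSpacePoint]
    have h1 : height X.1 = Real.exp (x (Fin.last n)) := e1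
    have h2 : height Y.1 = Real.exp (y (Fin.last n)) := e2
    calc Real.cosh 1 ≤ Real.cosh (x (Fin.last n) - y (Fin.last n)) := by
          rw [Real.cosh_le_cosh]; simpa using hi
      _ = 1 + (X.1 (Fin.last n) - Y.1 (Fin.last n)) ^ 2 / (2 * height X.1 * height Y.1) := by
          rw [e1, e2, h1, h2, Real.cosh_eq, neg_sub, Real.exp_sub, Real.exp_sub]
          field_simp
          ring
      _ ≤ _ := by gcongr
  · have e1 : X.1 i = 2 * Real.exp H * x i := by
      simp only [hXv, halfSpacePoint, if_neg hil]
    have e2 : Y.1 i = 2 * Real.exp H * y i := by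
      simp only [hYv, halfSpacePoint, if_neg hil]
    have hE := Real.exp_pos H
    have hden : 2 * height X.1 * height Y.1 ≤ 2 * Real.exp H ^ 2 := by
      have := mul_le_mul hxh.2 hyh.2 hYp.le hE.le
      rw [← hXv, ← hYv] at this
      nlinarith
    have hnum : 4 * Real.exp H ^ 2 ≤ (X.1 i - Y.1 i) ^ 2 := by
      rw [e1, e2, ← mul_sub, mul_pow, ← sq_abs (x i - y i)]
      have : 1 ≤ |x i - y i| ^ 2 := one_le_pow₀ hi
      nlinarith [sq_nonneg (Real.exp H)]
    have : 2 ≤ ‖X.1 - Y.1‖ ^ 2 / (2 * height X.1 * height Y.1) := by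
      rw [le_div_iff₀ (by positivity)]
      linarith
    linarith [cosh_one_le]

/-- Hyperbolic neighbourhoods of points of bounded height are contained in Euclidean ones and stay
away from the boundary. -/
theorem norm_sub_le_of_dist_lt {H : ℝ} (z y : HyperbolicSpace q)
    (hy : 1 ≤ height y.1 ∧ height y.1 ≤ Real.exp H) (hd : dist z y < 2) :
    ‖z.1 - y.1‖ ≤ 9 * Real.exp H ∧ 1 / 32 ≤ height z.1 := by
  have hc : Real.cosh (dist z y) - 1 ≤ 4 := by
    have : Real.cosh (dist z y) ≤ Real.cosh 2 := by
      rw [Real.cosh_le_cosh, abs_of_nonneg dist_nonneg]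
      simpa using hd.le
    linarith [cosh_two_le]
  have hc0 : 0 ≤ Real.cosh (dist z y) - 1 := by linarith [Real.one_le_cosh (dist z y)]
  have h1 := HyperbolicSpace.norm_sub_sq_le z y
  have h2 := HyperbolicSpace.norm_sub_sq_le y z
  have h3 := HyperbolicSpace.height_le y.1 z.1
  rw [norm_sub_rev y.1 z.1] at h2 h3
  rw [dist_comm y z] at h2
  have hz := z.2
  set s := ‖z.1 - y.1‖ with hs
  have hs0 : 0 ≤ s := norm_nonneg _
  set c := Real.cosh (dist z y) - 1
  set a := height y.1
  set b := height z.1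
  set E := Real.exp H
  constructor
  · have hE : 1 ≤ E := hy.1.trans hy.2
    have h4 : s ^ 2 ≤ 8 * E * (E + s) := by
      refine h1.trans ?_
      have : 2 * a * c ≤ 8 * E := by nlinarith
      exact mul_le_mul this (by linarith [hy.2]) (by linarith [hy.1]) (by linarith)
    by_contra! hlt
    nlinarith
  · by_contra! hlt
    have h4 : s ^ 2 ≤ 8 * b * (b + s) := by
      refine h2.trans ?_
      have : 2 * b * c ≤ 8 * b := by nlinarith
      exact mul_le_mul_of_nonneg_right this (by linarith)
    have h5 : 31 / 32 ≤ s := by linarith [hy.1]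
    nlinarith

theorem measurable_height : Measurable (height : EuclideanSpace ℝ (Fin q) → ℝ) :=
  HyperbolicSpace.continuous_height.measurable

theorem volume_pi_box (q : ℕ) (a b : Fin q → ℝ) :
    volume {x : EuclideanSpace ℝ (Fin q) | ∀ i, a i ≤ x i ∧ x i ≤ b i} =
      ∏ i, ENNReal.ofReal (b i - a i) := by
  have h := (PiLp.volume_preserving_ofLp (Fin q)).measure_preimage
    (s := Set.Icc a b) measurableSet_Icc.nullMeasurableSet
  rw [Real.volume_Icc_pi] at h
  rw [← h]
  congr 1
  ext x
  simp [Set.mem_Icc, Pi.le_def, forall_and]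

theorem measurableSet_pi_box (q : ℕ) (a b : Fin q → ℝ) :
    MeasurableSet {x : EuclideanSpace ℝ (Fin q) | ∀ i, a i ≤ x i ∧ x i ≤ b i} := by
  have h := (PiLp.volume_preserving_ofLp (Fin q)).measurable
    (measurableSet_Icc (a := a) (b := b))
  convert h using 1
  ext x
  simp [Set.mem_Icc, Pi.le_def, forall_and]

/-- The points of hyperbolic space above the height `1 / 32` in a Euclidean box. -/
def hyperbolicBox (c : ℝ) (b : Fin q → ℝ) : Set (HyperbolicSpace q) :=
  {z | 1 / 32 ≤ height z.1 ∧ ∀ i, -c ≤ z.1 i ∧ z.1 i ≤ b i + c}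

theorem measurable_val : Measurable fun x : HyperbolicSpace q => x.1 := measurable_subtype_coe

theorem measurableSet_hyperbolicBox (c : ℝ) (b : Fin q → ℝ) :
    MeasurableSet (hyperbolicBox c b) := by
  have h1 : MeasurableSet {z : HyperbolicSpace q | 1 / 32 ≤ height z.1} :=
    measurableSet_le measurable_const (measurable_height.comp measurable_val)
  exact h1.inter (measurable_val (measurableSet_pi_box q (fun _ => -c) fun i => b i + c))

theorem measurableEmbedding_val :
    MeasurableEmbedding fun x : HyperbolicSpace q => x.1 :=
  MeasurableEmbedding.subtype_coe (measurableSet_lt measurable_const measurable_height)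

instance : SFinite (volume : Measure (HyperbolicSpace q)) := by
  have : SigmaFinite (Measure.comap (fun x : HyperbolicSpace q => x.1)
      (volume : Measure (EuclideanSpace ℝ (Fin q)))) := by
    refine SigmaFinite.of_map _ measurable_val.aemeasurable ?_
    rw [measurableEmbedding_val.map_comap]
    infer_instance
  exact sFinite_of_absolutelyContinuous (withDensity_absolutelyContinuous _ _)

theorem volume_hyperbolicBox_le (c : ℝ) (b : Fin q → ℝ) :
    volume (hyperbolicBox c b) ≤
      ENNReal.ofReal (32 ^ q) * ∏ i, ENNReal.ofReal (b i + 2 * c) := by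
  set ν : Measure (HyperbolicSpace q) := Measure.comap (fun x : HyperbolicSpace q => x.1)
    (volume : Measure (EuclideanSpace ℝ (Fin q))) with hν
  change (ν.withDensity fun x : HyperbolicSpace q =>
    ENNReal.ofReal ((height x.1 ^ q)⁻¹)) (hyperbolicBox c b) ≤ _
  rw [withDensity_apply _ (measurableSet_hyperbolicBox c b)]
  have hν_le : ν (hyperbolicBox c b) ≤ ∏ i, ENNReal.ofReal (b i + 2 * c) := by
    have h := measurableEmbedding_val.comap_apply
      (volume : Measure (EuclideanSpace ℝ (Fin q))) (hyperbolicBox c b)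
    refine (le_of_eq h).trans ?_
    refine (measure_mono (t := {x : EuclideanSpace ℝ (Fin q) |
      ∀ i, (fun _ => -c) i ≤ x i ∧ x i ≤ (fun i => b i + c) i}) ?_).trans
      (le_of_eq ((volume_pi_box q _ _).trans ?_))
    · rintro _ ⟨z, hz, rfl⟩
      exact hz.2
    · refine Finset.prod_congr rfl fun i _ => ?_
      congr 1
      ring
  calc ∫⁻ x in hyperbolicBox c b, ENNReal.ofReal ((height x.1 ^ q)⁻¹) ∂ν
      ≤ ∫⁻ _ in hyperbolicBox c b, ENNReal.ofReal (32 ^ q) ∂ν := by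
        refine setLIntegral_mono measurable_const fun z hz => ENNReal.ofReal_le_ofReal ?_
        have h1 : 0 < height z.1 := z.2
        have h2 : (height z.1)⁻¹ ≤ 32 := by
          have := inv_anti₀ (by norm_num) hz.1
          simpa using this
        rw [← inv_pow]
        gcongr
    _ = ENNReal.ofReal (32 ^ q) * ν (hyperbolicBox c b) := by
        rw [setLIntegral_const]
    _ ≤ _ := by gcongr

end Hyperbolic

section Product

variable {r q : ℕ}

/-- The map of `ℝ^(r+q)` to `ℝ^r × ℍ^q`: the identity on the first factor and `toHyperbolic` on the
second one. -/
def toEucHyp (H : ℝ) (x : Fin r ⊕ Fin q → ℝ) : EucHyp r q :=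
  WithLp.toLp 2 (WithLp.toLp 2 fun i => x (.inl i),
    toHyperbolic (2 * Real.exp H) fun i => x (.inr i))

theorem continuous_toEucHyp (H : ℝ) : Continuous (toEucHyp (r := r) (q := q) H) := by
  refine (WithLp.prod_continuous_toLp 2 _ _).comp (Continuous.prodMk ?_ ?_)
  · exact (PiLp.continuous_toLp 2 _).comp (by fun_prop)
  · exact (continuous_toHyperbolic _).comp (by fun_prop)

theorem toEucHyp_injective (H : ℝ) : Function.Injective (toEucHyp (r := r) (q := q) H) := by
  intro x y h
  have h0 := congrArg WithLp.ofLp h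
  have h1 := congrArg (fun z => WithLp.ofLp (Prod.fst z)) h0
  have h2 := toHyperbolic_injective (by positivity) (congrArg Prod.snd h0)
  ext (i | i)
  · exact congrFun h1 i
  · exact congrFun h2 i

theorem one_le_dist_toEucHyp {H : ℝ} {x y : Fin r ⊕ Fin q → ℝ} (hx0 : ∀ i, 0 ≤ x i)
    (hy0 : ∀ i, 0 ≤ y i) (hx1 : ∀ i : Fin q, (i : ℕ) + 1 = q → x (.inr i) ≤ H)
    (hy1 : ∀ i : Fin q, (i : ℕ) + 1 = q → y (.inr i) ≤ H) (hxy : ∃ i, 1 ≤ |x i - y i|) :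
    1 ≤ dist (toEucHyp H x) (toEucHyp H y) := by
  obtain ⟨i | i, hi⟩ := hxy
  · refine le_trans ?_ (WithLp.dist_fst_le _ _)
    refine hi.trans ?_
    have := PiLp.norm_apply_le ((toEucHyp H x).fst - (toEucHyp H y).fst) i
    rw [← dist_eq_norm] at this
    simpa [toEucHyp] using this
  · exact (one_le_dist_toHyperbolic (fun i => hx0 _) (fun i => hy0 _) hx1 hy1 i hi).trans
      (WithLp.dist_snd_le (toEucHyp H x) (toEucHyp H y))

/-- The volume of the `1`-neighbourhood of a box is bounded by a multiple of the product of the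
sides. -/
theorem exists_volume_le (r q : ℕ) (H : ℝ) (hH : 0 ≤ H) : ∃ C : ℝ, 0 < C ∧
    ∀ (b : Fin r ⊕ Fin q → ℝ), (∀ i, 1 ≤ b i) →
      ∀ S : Set (Fin r ⊕ Fin q → ℝ), (∀ x ∈ S, ∀ i, 0 ≤ x i ∧ x i ≤ b i) →
        (∀ x ∈ S, ∀ i : Fin q, (i : ℕ) + 1 = q → x (.inr i) ≤ H) →
        eucHypVolume r q (Metric.cthickening 1 (toEucHyp H '' S)) ≤
          ENNReal.ofReal (C * ∏ i, b i) := by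
  set E := Real.exp H with hE
  have hE1 : 1 ≤ E := Real.one_le_exp hH
  refine ⟨5 ^ r * (32 ^ q * (20 * E) ^ q), by positivity, fun b hb S hS hSH => ?_⟩
  set A : Set (EuclideanSpace ℝ (Fin r)) :=
    {x | ∀ i, (fun _ => (-2 : ℝ)) i ≤ x i ∧ x i ≤ (fun i => b (.inl i) + 2) i} with hA
  set B : Set (HyperbolicSpace q) := hyperbolicBox (9 * E) fun i => 2 * E * b (.inr i) with hB
  have hsub : Metric.cthickening 1 (toEucHyp H '' S) ⊆ WithLp.ofLp ⁻¹' (A ×ˢ B) := by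
    refine (Metric.cthickening_subset_thickening' (by norm_num : (0 : ℝ) < 2) (by norm_num)
      _).trans ?_
    intro z hz
    obtain ⟨_, ⟨x, hx, rfl⟩, hd⟩ := Metric.mem_thickening_iff.1 hz
    have hd1 := (WithLp.dist_fst_le z (toEucHyp H x)).trans_lt hd
    have hd2 := (WithLp.dist_snd_le z (toEucHyp H x)).trans_lt hd
    refine ⟨fun i => ?_, ?_⟩
    · rw [dist_eq_norm] at hd1
      have h1 := (PiLp.norm_apply_le (z.fst - (toEucHyp H x).fst) i).trans hd1.le
      have h2 : |z.fst i - x (.inl i)| ≤ 2 := h1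
      have h3 := abs_le.1 h2
      have h4 := hS x hx (.inl i)
      change -2 ≤ z.fst i ∧ z.fst i ≤ b (.inl i) + 2
      constructor <;> linarith
    · have hh := height_halfSpacePoint_mem (lam := 2 * E) (x := fun i => x (.inr i)) hH
        (fun i => (hS x hx _).1) (hSH x hx)
      obtain ⟨h1, h2⟩ := norm_sub_le_of_dist_lt z.snd (toEucHyp H x).snd hh hd2
      refine ⟨h2, fun i => ?_⟩
      have h3 := abs_le.1 ((PiLp.norm_apply_le (z.snd.1 - (toEucHyp H x).snd.1) i).trans h1)
      change -(9 * E) ≤ z.snd.1 i - halfSpacePoint (2 * E) (fun i => x (.inr i)) i ∧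
        z.snd.1 i - halfSpacePoint (2 * E) (fun i => x (.inr i)) i ≤ 9 * E at h3
      have h4 : 0 ≤ halfSpacePoint (2 * E) (fun i => x (.inr i)) i ∧
          halfSpacePoint (2 * E) (fun i => x (.inr i)) i ≤ 2 * E * b (.inr i) := by
        have h5 := hS x hx (.inr i)
        have h6 := hb (.inr i)
        simp only [halfSpacePoint]
        split_ifs with hi
        · refine ⟨(Real.exp_pos _).le, (Real.exp_le_exp.2 (hSH x hx i hi)).trans ?_⟩
          rw [← hE]
          nlinarith
        · exact ⟨mul_nonneg (by positivity) h5.1, by gcongr; exact h5.2⟩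
      change -(9 * E) ≤ z.snd.1 i ∧ z.snd.1 i ≤ 2 * E * b (.inr i) + 9 * E
      constructor <;> linarith
  have hmeas : MeasurableSet (A ×ˢ B) :=
    (measurableSet_pi_box r _ _).prod (measurableSet_hyperbolicBox _ _)
  refine (measure_mono hsub).trans ?_
  rw [eucHypVolume, Measure.map_apply (WithLp.measurable_toLp 2 _)
    (WithLp.measurable_ofLp 2 _ hmeas)]
  change (volume.prod volume) (A ×ˢ B) ≤ _
  rw [Measure.prod_prod]
  have hAv : volume A ≤ ENNReal.ofReal (5 ^ r * ∏ i, b (.inl i)) := by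
    rw [hA, volume_pi_box, ← ENNReal.ofReal_prod_of_nonneg fun i _ => by linarith [hb (.inl i)]]
    refine ENNReal.ofReal_le_ofReal ?_
    calc ∏ i, (b (.inl i) + 2 - -2) ≤ ∏ i, (5 * b (.inl i)) := by
          refine Finset.prod_le_prod (fun i _ => ?_) fun i _ => ?_ <;> linarith [hb (.inl i)]
      _ = _ := by simp [Finset.prod_mul_distrib]
  have hBv : volume B ≤ ENNReal.ofReal (32 ^ q * ((20 * E) ^ q * ∏ i, b (.inr i))) := by
    refine (volume_hyperbolicBox_le _ _).trans ?_
    have hnn : ∀ i : Fin q, 0 ≤ 2 * E * b (.inr i) + 2 * (9 * E) := fun i => by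
      have := hb (.inr i)
      positivity
    rw [← ENNReal.ofReal_prod_of_nonneg fun i _ => hnn i, ← ENNReal.ofReal_mul (by positivity)]
    refine ENNReal.ofReal_le_ofReal (mul_le_mul_of_nonneg_left ?_ (by positivity))
    calc ∏ i, (2 * E * b (.inr i) + 2 * (9 * E)) ≤ ∏ i, (20 * E * b (.inr i)) := by
          refine Finset.prod_le_prod (fun i _ => hnn i) fun i _ => ?_
          nlinarith [hb (.inr i)]
      _ = _ := by simp [Finset.prod_mul_distrib]
  refine (mul_le_mul' hAv hBv).trans ?_
  have hbp : ∀ i, 0 ≤ b i := fun i => zero_le_one.trans (hb i)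
  rw [← ENNReal.ofReal_mul (mul_nonneg (by positivity) (Finset.prod_nonneg fun i _ => hbp _)),
    Fintype.prod_sum_type]
  exact ENNReal.ofReal_le_ofReal (le_of_eq (by ring))

end Product

/-! ### Routes through the layers -/

section Route

variable {k M : ℕ}

/-- The lattice point with grid coordinates `x`, on level `t` and in layer `h`. -/
def latticePoint (x : Fin k → ℤ) (t h : ℤ) : Fin k ⊕ Fin 2 → ℤ := Sum.elim x ![t, h]

/-- The layer that is reached from the end `b` after `n` changes of coordinates: the routes start
in layer `0`, reach their intermediate points in layers `k` and `k + 1`, and end in layer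
`2k + 1`. -/
def layer (k : ℕ) (b : Bool) (n : ℕ) : ℤ := cond b (2 * k + 1 - n) n

/-- The grid points of a route between its end `p` and its intermediate point `w`. -/
def mixed (p w : Fin k → Fin M) (n : ℕ) : Fin k → ℤ := fun i =>
  if (i : ℕ) < n then ((w i : ℕ) : ℤ) else ((p i : ℕ) : ℤ)

/-- The vertical part of a route, above its end `b`. -/
def columnSet (p : Bool → Fin k → Fin M) (t : ℤ) (b : Bool) : Set (Fin k ⊕ Fin 2 → ℤ) :=
  {x | (∀ i, x (.inl i) = (p b i : ℕ)) ∧ 1 ≤ x (.inr 0) ∧ x (.inr 0) ≤ t ∧ x (.inr 1) = layer k b 0}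

/-- The line, on level `t`, on which a route changes the `j`-th coordinate. -/
def lineSet (p : Bool → Fin k → Fin M) (w : Fin k → Fin M) (t : ℤ) (b : Bool) (j : Fin k) :
    Set (Fin k ⊕ Fin 2 → ℤ) :=
  {x | (∀ i < j, x (.inl i) = (w i : ℕ)) ∧ (∀ i, j < i → x (.inl i) = (p b i : ℕ)) ∧
    0 ≤ x (.inl j) ∧ x (.inl j) ≤ M - 1 ∧ x (.inr 0) = t ∧ x (.inr 1) = layer k b (j + 1)}

/-- The segment on level `1` that leads from the last layer back to layer `0`, in which the boxes
of the vertices are. -/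
def footSet (p : Bool → Fin k → Fin M) : Set (Fin k ⊕ Fin 2 → ℤ) :=
  {x | (∀ i, x (.inl i) = (p true i : ℕ)) ∧ x (.inr 0) = 1 ∧ 0 ≤ x (.inr 1) ∧
    x (.inr 1) ≤ 2 * k + 1}

/-- The route between the grid points `p false` and `p true` through `w`, on the level `t`. -/
def routeSet (p : Bool → Fin k → Fin M) (w : Fin k → Fin M) (t : ℤ) :
    Set (Fin k ⊕ Fin 2 → ℤ) :=
  {x | (∃ b, x ∈ columnSet p t b) ∨ (∃ b j, x ∈ lineSet p w t b j) ∨ x ∈ footSet p}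

theorem mixed_zero (p w : Fin k → Fin M) : mixed p w 0 = fun i => ((p i : ℕ) : ℤ) := by
  ext i; simp [mixed]

theorem mixed_last (p w : Fin k → Fin M) : mixed p w k = fun i => ((w i : ℕ) : ℤ) := by
  ext i; simp [mixed]

theorem mixed_mem (p w : Fin k → Fin M) (n : ℕ) (i : Fin k) :
    0 ≤ mixed p w n i ∧ mixed p w n i ≤ M - 1 := by
  have h1 := (w i).2
  have h2 := (p i).2
  simp only [mixed]
  split_ifs <;> omega

theorem latticePoint_mem_lineSet (p : Bool → Fin k → Fin M) (w : Fin k → Fin M) (t : ℤ) (b : Bool)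
    (j : Fin k) {n : ℕ} (h1 : (j : ℕ) ≤ n) (h2 : n ≤ j + 1) :
    latticePoint (mixed (p b) w n) t (layer k b (j + 1)) ∈ lineSet p w t b j := by
  refine ⟨fun i hi => ?_, fun i hi => ?_, (mixed_mem _ _ _ _).1, (mixed_mem _ _ _ _).2, rfl, rfl⟩
  · have hi : (i : ℕ) < j := hi
    simp only [latticePoint, mixed, Sum.elim_inl]
    rw [if_pos (by omega)]
  · have hi : (j : ℕ) < i := hi
    simp only [latticePoint, mixed, Sum.elim_inl]
    rw [if_neg (by omega)]

theorem layer_adj (x : Fin k → ℤ) (t : ℤ) {h h' : ℤ} (hh : |h - h'| = 1) :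
    (latticeGraph (Fin k ⊕ Fin 2)).Adj (latticePoint x t h) (latticePoint x t h') := by
  refine ⟨.inr 1, by simpa [latticePoint] using hh, ?_⟩
  rintro (i | i) hi
  · rfl
  · fin_cases i
    · rfl
    · exact absurd rfl hi

/-- From the top of the column above the end `b` to the intermediate point. -/
theorem joined_half (p : Bool → Fin k → Fin M) (w : Fin k → Fin M) {t : ℤ} (ht : 1 ≤ t) (b : Bool)
    {n : ℕ} (hn : n ≤ k) : LatticeJoined (routeSet p w t)
      (latticePoint (fun i => ((p b i : ℕ) : ℤ)) t (layer k b 0))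
      (latticePoint (mixed (p b) w n) t (layer k b n)) := by
  induction n with
  | zero =>
    rw [mixed_zero]
    exact .refl (.inl ⟨b, fun i => rfl, ht, le_rfl, rfl⟩)
  | succ n ih =>
    have ih := ih (by omega)
    have hmem := ih.2.1
    have h1 : latticePoint (mixed (p b) w n) t (layer k b (n + 1)) ∈ routeSet p w t :=
      .inr (.inl ⟨b, ⟨n, hn⟩, latticePoint_mem_lineSet p w t b ⟨n, hn⟩ le_rfl (Nat.le_succ n)⟩)
    refine (ih.trans (.of_adj hmem h1 (layer_adj _ _ ?_))).trans
      (.of_segment (.inl ⟨n, hn⟩) ?_ ?_)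
    · cases b <;> simp [layer]
    · rintro (i | i) hi
      · have : (i : ℕ) ≠ n := fun h => hi (congrArg Sum.inl (Fin.ext h))
        simp only [latticePoint, mixed, Sum.elim_inl]
        split_ifs <;> first | rfl | omega
      · rfl
    · intro x hx h2 h3
      obtain ⟨a1, a2, -, -, a5, a6⟩ :=
        latticePoint_mem_lineSet p w t b ⟨n, hn⟩ le_rfl (Nat.le_succ n)
      refine .inr (.inl ⟨b, ⟨n, hn⟩, fun i hi => ?_, fun i hi => ?_, ?_, ?_, ?_, ?_⟩)
      · rw [hx _ (fun h => hi.ne (Sum.inl_injective h)), a1 i hi]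
      · rw [hx _ (fun h => hi.ne' (Sum.inl_injective h)), a2 i hi]
      · exact (le_min (mixed_mem _ _ _ _).1 (mixed_mem _ _ _ _).1).trans h2
      · exact h3.trans (max_le (mixed_mem _ _ _ _).2 (mixed_mem _ _ _ _).2)
      · rw [hx _ (by simp), a5]
      · rw [hx _ (by simp), a6]

theorem joined_column (p : Bool → Fin k → Fin M) (w : Fin k → Fin M) {t : ℤ} (ht : 1 ≤ t)
    (b : Bool) : LatticeJoined (routeSet p w t)
      (latticePoint (fun i => ((p b i : ℕ) : ℤ)) 1 (layer k b 0))
      (latticePoint (fun i => ((p b i : ℕ) : ℤ)) t (layer k b 0)) := by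
  refine .of_segment (.inr 0) ?_ fun x hx h1 h2 => .inl ⟨b, fun i => ?_, ?_, ?_, ?_⟩
  · rintro (i | i) hi
    · rfl
    · fin_cases i
      · exact absurd rfl hi
      · rfl
  · rw [hx _ (by simp)]
    rfl
  · simpa [latticePoint, ht] using h1
  · simpa [latticePoint, ht] using h2
  · rw [hx _ (by simp)]
    rfl

/-- The route joins the ports of its two ends, which are on level `1` in layer `0`. -/
theorem joined_routeSet (p : Bool → Fin k → Fin M) (w : Fin k → Fin M) {t : ℤ} (ht : 1 ≤ t) :
    LatticeJoined (routeSet p w t) (latticePoint (fun i => ((p false i : ℕ) : ℤ)) 1 0)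
      (latticePoint (fun i => ((p true i : ℕ) : ℤ)) 1 0) := by
  have h0 := (joined_column p w ht false).trans (joined_half p w ht false le_rfl)
  have h1 := (joined_column p w ht true).trans (joined_half p w ht true le_rfl)
  rw [mixed_last] at h0 h1
  have hmid := LatticeJoined.of_adj h0.2.1 h1.2.1 (layer_adj _ _ (by simp [layer]; ring_nf; simp))
  have hfoot : LatticeJoined (routeSet p w t)
      (latticePoint (fun i => ((p true i : ℕ) : ℤ)) 1 (layer k true 0))
      (latticePoint (fun i => ((p true i : ℕ) : ℤ)) 1 0) := by
    refine .of_segment (.inr 1) ?_ fun x hx h1 h2 => .inr (.inr ⟨fun i => ?_, ?_, ?_, ?_⟩)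
    · rintro (i | i) hi
      · rfl
      · fin_cases i
        · rfl
        · exact absurd rfl hi
    · rw [hx _ (by simp)]
      rfl
    · rw [hx _ (by simp)]
      rfl
    · exact (le_min (by simp [latticePoint, layer]; positivity) (by simp [latticePoint])).trans h1
    · exact h2.trans (max_le (by simp [latticePoint, layer])
        (by simp [latticePoint]; positivity))
  exact ((h0.trans hmid).trans h1.symm).trans hfoot

theorem one_le_of_mem_routeSet {p : Bool → Fin k → Fin M} {w : Fin k → Fin M} {t : ℤ} (ht : 1 ≤ t)
    {x : Fin k ⊕ Fin 2 → ℤ} (hx : x ∈ routeSet p w t) : 1 ≤ x (.inr 0) := by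
  rcases hx with ⟨b, -, h, -⟩ | ⟨b, j, -, -, -, -, h, -⟩ | ⟨-, h, -⟩ <;> omega

/-- Below level `2`, a route stays above the grid points of its two ports. -/
theorem mem_routeSet_low {p : Bool → Fin k → Fin M} {w : Fin k → Fin M} {t : ℤ} (ht : 2 ≤ t)
    {x : Fin k ⊕ Fin 2 → ℤ} (hx : x ∈ routeSet p w t) (h1 : x (.inr 0) ≤ 1) :
    ∃ b, ∀ i, x (.inl i) = (p b i : ℕ) := by
  rcases hx with ⟨b, h, -⟩ | ⟨b, j, -, -, -, -, h, -⟩ | ⟨h, -⟩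
  · exact ⟨b, h⟩
  · omega
  · exact ⟨true, h⟩

theorem layer_injective {b b' : Bool} {j j' : Fin k}
    (h : layer k b (j + 1) = layer k b' (j' + 1)) : b = b' ∧ j = j' := by
  have h1 := j.2
  have h2 := j'.2
  cases b <;> cases b' <;> simp only [layer, cond_true, cond_false, Nat.cast_add, Nat.cast_one] at h
  · exact ⟨rfl, Fin.ext (by omega)⟩
  · omega
  · omega
  · exact ⟨rfl, Fin.ext (by omega)⟩

theorem layer_zero_ne (b b' : Bool) (j : Fin k) : layer k b 0 ≠ layer k b' (j + 1) := by
  have h1 := j.2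
  cases b <;> cases b' <;>
    simp only [layer, cond_true, cond_false, Nat.cast_add, Nat.cast_one, Nat.cast_zero] <;> omega

/-- Two routes with distinct ends are disjoint if they share no line. -/
theorem routeSet_disjoint {p p' : Bool → Fin k → Fin M} {w w' : Fin k → Fin M} {t t' : ℤ}
    (ht : 2 ≤ t) (ht' : 2 ≤ t') (hp : ∀ b b', p b ≠ p' b')
    (hline : t = t' → ∀ b j, (∀ i < j, w i = w' i) → ¬ ∀ i, j < i → p b i = p' b i) :
    Disjoint (routeSet p w t) (routeSet p' w' t') := by
  rw [Set.disjoint_left]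
  intro x hx hx'
  have hcol : ∀ b b', (∀ i, x (.inl i) = (p b i : ℕ)) → (∀ i, x (.inl i) = (p' b' i : ℕ)) →
      False := by
    intro b b' h h'
    refine hp b b' (funext fun i => Fin.ext ?_)
    have := (h i).symm.trans (h' i)
    exact_mod_cast this
  rcases hx with ⟨b, h1, h2, h3, h4⟩ | ⟨b, j, h1, h2, -, -, h3, h4⟩ | ⟨h1, h2, -⟩ <;>
  rcases hx' with ⟨b', h1', h2', h3', h4'⟩ | ⟨b', j', h1', h2', -, -, h3', h4'⟩ | ⟨h1', h2', -⟩
  · exact hcol _ _ h1 h1'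
  · exact layer_zero_ne _ _ _ (h4.symm.trans h4')
  · exact hcol _ _ h1 h1'
  · exact layer_zero_ne _ _ _ (h4'.symm.trans h4)
  · obtain ⟨rfl, rfl⟩ := layer_injective (h4.symm.trans h4')
    refine hline (h3.symm.trans h3') b j (fun i hi => Fin.ext ?_) fun i hi => Fin.ext ?_
    · have := (h1 i hi).symm.trans (h1' i hi)
      exact_mod_cast this
    · have := (h2 i hi).symm.trans (h2' i hi)
      exact_mod_cast this
  · omega
  · exact hcol _ _ h1 h1'
  · omega
  · exact hcol _ _ h1 h1'

theorem mem_of_mem_routeSet {p : Bool → Fin k → Fin M} {w : Fin k → Fin M} {t : ℤ} (ht : 1 ≤ t)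
    {x : Fin k ⊕ Fin 2 → ℤ} (hx : x ∈ routeSet p w t) :
    (∀ i, 0 ≤ x (.inl i) ∧ x (.inl i) ≤ M - 1) ∧ (0 ≤ x (.inr 0) ∧ x (.inr 0) ≤ t) ∧
      0 ≤ x (.inr 1) ∧ x (.inr 1) ≤ 2 * k + 1 := by
  have hM : ∀ a : Fin M, (0 : ℤ) ≤ ((a : ℕ) : ℤ) ∧ ((a : ℕ) : ℤ) ≤ M - 1 := fun a => by
    have := a.2
    omega
  rcases hx with ⟨b, h1, h2, h3, h4⟩ | ⟨b, j, h1, h2, h5, h6, h3, h4⟩ | ⟨h1, h2, h3, h4⟩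
  · refine ⟨fun i => ?_, ⟨by omega, h3⟩, ?_⟩
    · rw [h1]
      exact hM _
    · rw [h4]
      cases b <;> simp [layer] <;> positivity
  · refine ⟨fun i => ?_, ⟨by omega, h3.le⟩, ?_⟩
    · rcases lt_trichotomy i j with hij | rfl | hij
      · rw [h1 i hij]
        exact hM _
      · exact ⟨h5, h6⟩
      · rw [h2 i hij]
        exact hM _
    · rw [h4]
      have := j.2
      cases b <;> simp only [layer, cond_true, cond_false] <;> push_cast <;> constructor <;> omega
  · refine ⟨fun i => ?_, ⟨by omega, by omega⟩, h3, h4⟩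
    rw [h1]
    exact hM _

end Route

/-! ### The layout of a graph of bounded degree -/

section Construction

variable {V : Type u} {Γ : SimpleGraph V}

/-- The edges at a vertex can be numbered from `0` to the degree bound. -/
theorem exists_port_numbers [Fintype V] [DecidableRel Γ.Adj] {d : ℕ} (hd : Γ.maxDegree ≤ d) :
    ∃ m : Γ.edgeSet → Bool → ℕ, (∀ e b, m e b ≤ d) ∧
      ∀ e e' b b', edgeEnd Γ e b = edgeEnd Γ e' b' → m e b = m e' b' → e = e' := by
  classical
  have h : ∀ v : V, ∃ f : Sym2 V → ℕ, (∀ e ∈ Γ.incidenceFinset v, f e ≤ d) ∧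
      Set.InjOn f (Γ.incidenceFinset v) := by
    intro v
    have hcard : (Γ.incidenceFinset v).card ≤ d := by
      rw [SimpleGraph.card_incidenceFinset_eq_degree]
      exact (Γ.degree_le_maxDegree v).trans hd
    let φ := (Γ.incidenceFinset v).equivFin
    refine ⟨fun e => if he : e ∈ Γ.incidenceFinset v then (φ ⟨e, he⟩ : ℕ) else 0, ?_, ?_⟩
    · intro e he
      simp only [dif_pos he]
      have := (φ ⟨e, he⟩).2
      omega
    · intro e he e' he' hee
      have he : e ∈ Γ.incidenceFinset v := he
      have he' : e' ∈ Γ.incidenceFinset v := he'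
      simp only [dif_pos he, dif_pos he'] at hee
      exact congrArg Subtype.val (φ.injective (Fin.ext hee))
  choose f hf hinj using h
  have hmem : ∀ (e : Γ.edgeSet) b, e.1 ∈ Γ.incidenceFinset (edgeEnd Γ e b) := fun e b => by
    rw [SimpleGraph.mem_incidenceFinset]
    exact ⟨e.2, edgeEnd_mem Γ e b⟩
  refine ⟨fun e b => f (edgeEnd Γ e b) e.1, fun e b => hf _ _ (hmem e b), ?_⟩
  intro e e' b b' hv hm
  refine Subtype.ext (hinj (edgeEnd Γ e b) (hmem e b) ?_ ?_)
  · rw [hv]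
    exact hmem e' b'
  · simpa only [hv] using hm

theorem block_eq {d a b m : ℕ} (hm : m ≤ d) (h1 : (d + 1) * a ≤ (d + 1) * b + m)
    (h2 : (d + 1) * b + m ≤ (d + 1) * a + d) : a = b := by
  rcases lt_trichotomy a b with h | h | h
  · have := Nat.mul_le_mul_left (d + 1) (Nat.succ_le_of_lt h)
    rw [Nat.mul_succ] at this
    omega
  · exact h
  · have := Nat.mul_le_mul_left (d + 1) (Nat.succ_le_of_lt h)
    rw [Nat.mul_succ] at this
    omega

/-- A graph of maximal degree at most `d`, whose vertices are placed in the grid `[L]^k`, has a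
layout in a box whose sides are bounded by a multiple of `L`, except for one side that does not
depend on the graph. Each vertex is blown up to a cube of `d + 1` points per side, on the diagonal
of which its ports are. -/
theorem exists_layout [Fintype V] [DecidableRel Γ.Adj] {d k L : ℕ} (hd : Γ.maxDegree ≤ d)
    (hk : 0 < k) (hL : 0 < L) (u : V → Fin k → Fin L) (hu : Function.Injective u) :
    ∃ D : Layout Γ (Fin k ⊕ Fin 2) (.inr 0),
      (∀ v, D.box v ⊆ Set.Icc 0
        (latticePoint (fun _ => ((2 * k + 2) * ((d + 1) * L) : ℕ))
          ((2 * k + 2) * ((d + 1) * L) : ℕ) (2 * k + 1))) ∧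
      ∀ e, D.route e ⊆ Set.Icc 0
        (latticePoint (fun _ => ((2 * k + 2) * ((d + 1) * L) : ℕ))
          ((2 * k + 2) * ((d + 1) * L) : ℕ) (2 * k + 1)) := by
  obtain ⟨m, hm, hminj⟩ := exists_port_numbers hd
  have hlt : ∀ v i m, m ≤ d → (d + 1) * (u v i : ℕ) + m < (d + 1) * L := by
    intro v i m hm
    have := Nat.mul_le_mul_left (d + 1) (Nat.succ_le_of_lt (u v i).2)
    rw [Nat.mul_succ] at this
    omega
  let P : Bool → Γ.edgeSet → Fin k → Fin ((d + 1) * L) := fun b e i =>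
    ⟨(d + 1) * (u (edgeEnd Γ e b) i : ℕ) + m e b, hlt _ _ _ (hm e b)⟩
  have hPval : ∀ b e i, ((P b e i : ℕ)) = (d + 1) * (u (edgeEnd Γ e b) i : ℕ) + m e b :=
    fun _ _ _ => rfl
  have hblock : ∀ v b e, (∀ i, (d + 1) * (u v i : ℕ) ≤ P b e i ∧
      (P b e i : ℕ) ≤ (d + 1) * (u v i : ℕ) + d) → v = edgeEnd Γ e b := by
    intro v b e h
    refine hu (funext fun i => Fin.ext ?_)
    have := h i
    rw [hPval] at this
    exact block_eq (hm e b) this.1 this.2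
  have hP : ∀ b b' e e', P b e = P b' e' → e = e' := by
    intro b b' e e' h
    have hv : edgeEnd Γ e b = edgeEnd Γ e' b' := by
      refine hblock _ _ _ fun i => ?_
      rw [← h, hPval]
      have := hm e b
      omega
    refine hminj e e' b b' hv ?_
    have := congrArg Fin.val (congrFun h ⟨0, hk⟩)
    rw [hPval, hPval, hv] at this
    omega
  obtain ⟨w, t, hwt⟩ := exists_routing k ((d + 1) * L) P fun b e e' => hP b b e e'
  have hM : 1 ≤ (d + 1) * L := Nat.mul_pos (Nat.succ_pos d) hL
  have h2 : ∀ e, (2 : ℤ) ≤ ((t e : ℕ) : ℤ) + 2 := fun e => by omega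
  have h1 : ∀ e, (1 : ℤ) ≤ ((t e : ℕ) : ℤ) + 2 := fun e => by omega
  let D : Layout Γ (Fin k ⊕ Fin 2) (.inr 0) :=
    { lo := fun v => latticePoint (fun i => ((d + 1) * (u v i : ℕ) : ℕ)) 0 0
      hi := fun v => latticePoint (fun i => ((d + 1) * (u v i : ℕ) + d : ℕ)) 1 0
      center := fun v => latticePoint (fun i => ((d + 1) * (u v i : ℕ) : ℕ)) 0 0
      port := fun e b => latticePoint (fun i => ((P b e i : ℕ) : ℤ)) 1 0
      route := fun e => routeSet (fun b => P b e) (w e) ((t e : ℕ) + 2)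
      center_mem := by
        intro v
        refine ⟨le_rfl, ?_⟩
        rintro (i | i)
        · simp [latticePoint]
        · fin_cases i <;> simp [latticePoint]
      center_level := fun v => rfl
      box_disjoint := by
        intro v v' hne
        rw [Set.disjoint_left]
        rintro x hx hx'
        refine hne (hu (funext fun i => Fin.ext ?_))
        have a1 : (((d + 1) * (u v i : ℕ) : ℕ) : ℤ) ≤ x (.inl i) := hx.1 (.inl i)
        have a2 : x (.inl i) ≤ ((d + 1) * (u v i : ℕ) + d : ℕ) := hx.2 (.inl i)
        have a3 : (((d + 1) * (u v' i : ℕ) : ℕ) : ℤ) ≤ x (.inl i) := hx'.1 (.inl i)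
        have a4 : x (.inl i) ≤ ((d + 1) * (u v' i : ℕ) + d : ℕ) := hx'.2 (.inl i)
        rcases le_total ((d + 1) * (u v i : ℕ)) ((d + 1) * (u v' i : ℕ)) with h | h
        · exact block_eq (m := 0) (Nat.zero_le d) (by omega) (by omega)
        · exact (block_eq (m := 0) (Nat.zero_le d) (by omega) (by omega)).symm
      port_mem := by
        intro e b
        have hmb := hm e b
        constructor
        · rintro (i | i)
          · simp [latticePoint, hPval]
          · fin_cases i <;> simp [latticePoint]
        · rintro (i | i)
          · simp [latticePoint, hPval, hmb]
          · fin_cases i <;> simp [latticePoint]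
      port_level := fun e b => rfl
      route_level := fun e x hx => one_le_of_mem_routeSet (h1 e) hx
      route_joined := fun e => joined_routeSet (fun b => P b e) (w e) (h1 e)
      route_disjoint := by
        intro e e' hne
        refine routeSet_disjoint (h2 e) (h2 e') (fun b b' h => hne (hP b b' e e' h)) fun ht =>
          hwt e e' hne (Fin.ext ?_)
        omega
      route_box_disjoint := by
        intro e v hv
        rw [Set.disjoint_left]
        intro x hx hxv
        obtain ⟨b, hb⟩ := mem_routeSet_low (h2 e) hx (hxv.2 (.inr 0))
        refine hv ?_
        rw [hblock v b e fun i => ?_]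
        · exact edgeEnd_mem Γ e b
        · have a1 : (((d + 1) * (u v i : ℕ) : ℕ) : ℤ) ≤ x (.inl i) := hxv.1 (.inl i)
          have a2 : x (.inl i) ≤ ((d + 1) * (u v i : ℕ) + d : ℕ) := hxv.2 (.inl i)
          rw [hb i] at a1 a2
          exact ⟨by exact_mod_cast a1, by exact_mod_cast a2⟩ }
  have hK : (d + 1) * L ≤ (2 * k + 2) * ((d + 1) * L) := Nat.le_mul_of_pos_left _ (by omega)
  refine ⟨D, fun v x hx => ?_, fun e x hx => ?_⟩
  · have b0 : (0 : ℤ) ≤ x (.inr 0) := hx.1 (.inr 0)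
    have b1 : x (.inr 0) ≤ 1 := hx.2 (.inr 0)
    have c0 : (0 : ℤ) ≤ x (.inr 1) := hx.1 (.inr 1)
    have c1 : x (.inr 1) ≤ 0 := hx.2 (.inr 1)
    have a0 : ∀ i, 0 ≤ x (.inl i) ∧ x (.inl i) ≤ ((2 * k + 2) * ((d + 1) * L) : ℕ) := fun i => by
      have a1 : (((d + 1) * (u v i : ℕ) : ℕ) : ℤ) ≤ x (.inl i) := hx.1 (.inl i)
      have a2 : x (.inl i) ≤ ((d + 1) * (u v i : ℕ) + d : ℕ) := hx.2 (.inl i)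
      have := hlt v i d le_rfl
      omega
    constructor
    · rintro (i | i)
      · exact (a0 i).1
      · fin_cases i
        · exact b0
        · exact c0
    · rintro (i | i)
      · exact (a0 i).2
      · fin_cases i
        · change x (.inr 0) ≤ ((2 * k + 2) * ((d + 1) * L) : ℕ)
          omega
        · change x (.inr 1) ≤ 2 * k + 1
          omega
  · obtain ⟨a, ⟨b0, b1⟩, c0, c1⟩ := mem_of_mem_routeSet (h1 e) hx
    have ht := (t e).2
    have hT : (2 * k * ((d + 1) * L)) + 2 ≤ (2 * k + 2) * ((d + 1) * L) := by
      have := Nat.add_mul (2 * k) 2 ((d + 1) * L)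
      omega
    constructor
    · rintro (i | i)
      · exact (a i).1
      · fin_cases i
        · exact b0
        · exact c0
    · rintro (i | i)
      · have := a i
        change x (.inl i) ≤ ((2 * k + 2) * ((d + 1) * L) : ℕ)
        omega
      · fin_cases i
        · change x (.inr 0) ≤ ((2 * k + 2) * ((d + 1) * L) : ℕ)
          omega
        · exact c1

end Construction

/-! ### The volume bound -/

/-- The coordinates of `ℝ^r × ℍ^q`, numbered so that the last one corresponds to the layer. If
`0 < q`, this is the height. -/
def coordEquiv {r q k : ℕ} (h : r + q = k + 2) : Fin r ⊕ Fin q ≃ Fin k ⊕ Fin 2 :=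
  finSumFinEquiv.trans ((finCongr h).trans finSumFinEquiv.symm)

theorem coordEquiv_last {r q k : ℕ} (h : r + q = k + 2) {i : Fin q} (hi : (i : ℕ) + 1 = q) :
    coordEquiv h (.inr i) = .inr 1 := by
  rw [coordEquiv, Equiv.trans_apply, Equiv.trans_apply, Equiv.symm_apply_eq]
  ext
  simp
  omega

/-- The number of points per side of a `k`-dimensional grid with room for `N` points. -/
theorem exists_grid_side {k : ℕ} (hk : 0 < k) (N : ℕ) : ∃ L : ℕ, 0 < L ∧ N ≤ L ^ k ∧
    (0 < N → (L : ℝ) ^ (k + 1) ≤ 3 ^ (k + 1) * (N : ℝ) ^ (1 + 1 / (k : ℝ))) := by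
  have hk' : (k : ℝ) ≠ 0 := by positivity
  set a : ℝ := (N : ℝ) ^ (1 / (k : ℝ)) with ha
  have ha0 : 0 ≤ a := by positivity
  have hak : a ^ k = N := by
    rw [ha, ← Real.rpow_natCast, ← Real.rpow_mul (by positivity), one_div_mul_cancel hk',
      Real.rpow_one]
  refine ⟨⌈a⌉₊ + 1, by omega, ?_, fun hN => ?_⟩
  · have h1 : a ≤ ((⌈a⌉₊ + 1 : ℕ) : ℝ) := by
      push_cast
      linarith [Nat.le_ceil a]
    have h2 : (N : ℝ) ≤ ((⌈a⌉₊ + 1 : ℕ) : ℝ) ^ k := by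
      rw [← hak]
      gcongr
    exact_mod_cast h2
  · have hN' : (1 : ℝ) ≤ N := by exact_mod_cast hN
    have ha1 : 1 ≤ a := Real.one_le_rpow hN' (by positivity)
    have h1 : ((⌈a⌉₊ + 1 : ℕ) : ℝ) ≤ 3 * a := by
      push_cast
      linarith [Nat.ceil_lt_add_one ha0]
    calc ((⌈a⌉₊ + 1 : ℕ) : ℝ) ^ (k + 1) ≤ (3 * a) ^ (k + 1) := by gcongr
      _ = 3 ^ (k + 1) * (N : ℝ) ^ (1 + 1 / (k : ℝ)) := by
        rw [mul_pow, pow_succ a, hak, Real.rpow_add (by positivity), Real.rpow_one]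

end ThickEmbedding

end

open ThickEmbedding in
theorem theorem1p6 (r q d : ℕ) (hqr : 3 ≤ q + r) :
    ∃ C : ℝ, 0 < C ∧
      ∀ (V : Type*) [Fintype V] (Γ : SimpleGraph V) [DecidableRel Γ.Adj], Γ.maxDegree ≤ d →
        ∃ g : ThickEmbedding.Realization Γ → ThickEmbedding.EucHyp r q,
          ThickEmbedding.IsThickEmbedding Γ 1 g ∧
          ThickEmbedding.imageVolume (ThickEmbedding.eucHypVolume r q) g ≤
            ENNReal.ofReal
              (C * (Fintype.card V : ℝ) ^ (1 + 1 / ((q : ℝ) + (r : ℝ) - 2))) := by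
  obtain ⟨k, hk⟩ : ∃ k, r + q = k + 2 := ⟨r + q - 2, by omega⟩
  have hk0 : 0 < k := by omega
  have hkR : (q : ℝ) + (r : ℝ) - 2 = k := by
    have : (r : ℝ) + q = k + 2 := by exact_mod_cast hk
    linarith
  rw [hkR]
  obtain ⟨C, hC, hvol⟩ := exists_volume_le r q (2 * k + 1) (by positivity)
  refine ⟨C * ((2 * k + 1) * ((2 * k + 2) * (d + 1) * 3) ^ (k + 1)), by positivity, ?_⟩
  intro V _ Γ _ hd
  obtain ⟨L, hL, hcard, hLN⟩ := exists_grid_side hk0 (Fintype.card V)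
  obtain ⟨u⟩ : Nonempty (V ↪ (Fin k → Fin L)) :=
    Function.Embedding.nonempty_of_card_le (by simpa using hcard)
  obtain ⟨D, hbox, hroute⟩ := exists_layout hd hk0 hL u u.injective
  set K : ℕ := (2 * k + 2) * ((d + 1) * L) with hK
  set B : Fin k ⊕ Fin 2 → ℤ := latticePoint (fun _ => (K : ℤ)) K (2 * k + 1) with hB
  have hmem : ∀ x i, 0 ≤ D.toMap x i ∧ D.toMap x i ≤ B i := fun x i => by
    simpa using D.toMap_mem hbox hroute x i
  let σ := coordEquiv hk
  let f : Realization Γ → Fin r ⊕ Fin q → ℝ := fun x i => D.toMap x (σ i)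
  have hf0 : ∀ x i, 0 ≤ f x i := fun x i => (hmem x _).1
  have hf1 : ∀ x (i : Fin q), (i : ℕ) + 1 = q → f x (.inr i) ≤ 2 * k + 1 := fun x i hi => by
    have := (hmem x (σ (.inr i))).2
    simp only [σ, coordEquiv_last hk hi] at this
    simpa [f, σ, coordEquiv_last hk hi, hB, latticePoint] using this
  have hdist : ∀ x y, (∃ i, 1 ≤ |D.toMap x i - D.toMap y i|) →
      1 ≤ dist (toEucHyp (2 * k + 1) (f x)) (toEucHyp (2 * k + 1) (f y)) := by
    rintro x y ⟨i, hi⟩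
    refine one_le_dist_toEucHyp (hf0 x) (hf0 y) (hf1 x) (hf1 y) ⟨σ.symm i, ?_⟩
    simpa [f] using hi
  have hcont : Continuous f := continuous_pi fun i => (continuous_apply _).comp D.continuous_toMap
  have hinj : Function.Injective f := fun x y h => D.injective_toMap <| by
    ext i
    simpa [f] using congrFun h (σ.symm i)
  refine ⟨fun x => toEucHyp (2 * k + 1) (f x), ⟨?_, fun v w hvw => hdist _ _ (D.vertex_ne hvw),
    fun e v hv t => hdist _ _ (D.edgePoint_vertex hv t),
    fun e e' h s t => hdist _ _ (D.edgePoint_edgePoint h s t)⟩, ?_⟩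
  · exact (((continuous_toEucHyp _).comp hcont).isClosedEmbedding
      ((toEucHyp_injective _).comp hinj)).isEmbedding
  rcases isEmpty_or_nonempty V with hV | hV
  · have : IsEmpty (Realization Γ) := ⟨fun x => by
      rcases x.cases with ⟨v, -⟩ | ⟨e, -⟩
      · exact hV.false v
      · exact hV.false (edgeEnd Γ e true)⟩
    simp [imageVolume, Set.range_eq_empty]
  have hK1 : 1 ≤ K := Nat.mul_pos (by omega) (Nat.mul_pos (by omega) hL)
  have hK1' : (1 : ℤ) ≤ K := by exact_mod_cast hK1
  have hB1 : ∀ i, 1 ≤ B i := by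
    rintro (i | i)
    · exact hK1'
    · fin_cases i
      · exact hK1'
      · change (1 : ℤ) ≤ 2 * k + 1
        omega
  have hv := hvol (fun i => (B (σ i) : ℝ)) (fun i => by exact_mod_cast hB1 _) (Set.range f)
    (by rintro _ ⟨x, rfl⟩ i; exact hmem x _) (by rintro _ ⟨x, rfl⟩ i hi; exact hf1 x i hi)
  rw [← Set.range_comp] at hv
  refine hv.trans (ENNReal.ofReal_le_ofReal ?_)
  have hprod : ∏ i, (B (σ i) : ℝ) = (2 * k + 1) * (K : ℝ) ^ (k + 1) := by
    rw [Equiv.prod_comp σ fun i => (B i : ℝ), Fintype.prod_sum_type]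
    simp [hB, latticePoint]
    ring
  rw [hprod, hK]
  push_cast
  calc C * ((2 * k + 1) * ((2 * k + 2) * ((d + 1) * L)) ^ (k + 1))
      = C * ((2 * k + 1) * ((2 * k + 2) * (d + 1)) ^ (k + 1)) * (L : ℝ) ^ (k + 1) := by
        rw [← mul_assoc (2 * (k : ℝ) + 2), mul_pow _ (L : ℝ)]
        ring
    _ ≤ C * ((2 * k + 1) * ((2 * k + 2) * (d + 1)) ^ (k + 1)) *
          (3 ^ (k + 1) * (Fintype.card V : ℝ) ^ (1 + 1 / (k : ℝ))) := by
        gcongr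
        exact hLN Fintype.card_pos
    _ = C * ((2 * k + 1) * ((2 * k + 2) * (d + 1) * 3) ^ (k + 1)) *
          (Fintype.card V : ℝ) ^ (1 + 1 / (k : ℝ)) := by
        rw [mul_pow _ (3 : ℝ)]
        ring
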